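/- Let $G=(V,E)$ be a finite simple graph. A set of vertices is independent if no two of its members are adjacent, and it is a maximal independent set if it is not properly contained in another independent set. Let $B$ be an induced complete bipartite subgraph of $G$ with vertex sets of bipartition $B_X$ and $B_Y$ (that is, $B_X$ and $B_Y$ are disjoint independent sets of $G$ and every vertex of $B_X$ is adjacent to every vertex of $B_Y$). $B$ is called generating if there is an independent set $S$ of $G$ such that both $S\cup B_X$ and $S\cup B_Y$ are maximal independent sets of $G$. Theorem. The following problem can be solved in $O\left(|V|^2(|V|+|E|)\right)$ time. Input: a graph $G=(V,E)$ that contains no cycle of length 6 and no cycle of length 7 as a (not necessarily induced) subgraph, and an induced complete bipartite subgraph $B$ of $G$, given by $B_X$ and $B_Y$. Question: is $B$ generating? Here time is the number of steps on a word RAM: there are a single program and constants $c, C$ such that on every input with $V=\{0,\dots,n-1\}$, where $G$ is given by adjacency lists (in any order) and $B_X$, $B_Y$ by characteristic vectors, the program halts with the correct answer (1 for yes, 0 for no) after at most $C\left(n^2(n+|E|)+1\right)$ steps, each step being one elementary operation (constant, memory access with computed addresses, $+$, $-$ truncated at $0$, $\times$, comparison, or branching), and only numbers smaller than $(n+2)^c$,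 that is, words of $O(\log n)$ bits, occur. -/

import Mathlib

/-! ### Generating subgraphs -/

/-- `X` and `Y` are the vertex sets of bipartition of an induced complete bipartite subgraph
of `G`. -/
structure IsInducedCompleteBipartite {V : Type*} (G : SimpleGraph V) (X Y : Set V) : Prop where
  disjoint : Disjoint X Y
  indepX : G.IsIndepSet X
  indepY : G.IsIndepSet Y
  adj : ∀ x ∈ X, ∀ y ∈ Y, G.Adj x y

/-- The induced complete bipartite subgraph with vertex sets of bipartition `X` and `Y` is
generating: some independent set `S` makes both `S ∪ X` and `S ∪ Y` maximal independent sets. -/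
def IsGenerating {V : Type*} (G : SimpleGraph V) (X Y : Set V) : Prop :=
  ∃ S : Set V, G.IsIndepSet S ∧
    Maximal (fun T : Set V => G.IsIndepSet T) (S ∪ X) ∧
    Maximal (fun T : Set V => G.IsIndepSet T) (S ∪ Y)

/-! ### Random access machines

A program of a word RAM, in structured form. The memory consists of natural number registers
`var 0, var 1, ...` and of arrays `arr 0, arr 1, ...`. The names of registers and arrays are fixed
in the program text, so a program uses finitely many of them, while the index of an array cell is
computed at run time. Every elementary operation takes one step, and a run is stuck
as soon as a number that does not fit in a machine word (that is, a number `≥ W`) occurs. -/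

namespace Ram

/-- A memory configuration. -/
structure State where
  var : ℕ → ℕ
  arr : ℕ → ℕ → ℕ

/-- The binary operations of the machine. -/
inductive Op where
  | add | sub | mul | lt | eq

/-- Subtraction is truncated at `0`; comparisons return `1` (true) or `0` (false). -/
def Op.val : Op → ℕ → ℕ → ℕ
  | .add, a, b => a + b
  | .sub, a, b => a - b
  | .mul, a, b => a * b
  | .lt, a, b => if a < b then 1 else 0
  | .eq, a, b => if a = b then 1 else 0

/-- Arithmetic terms: a literal, the content of register `x`, the cell of array `a` whose index
is the value of `e`, and a binary operation. -/
inductive Term where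
  | lit (k : ℕ)
  | var (x : ℕ)
  | get (a : ℕ) (e : Term)
  | bin (o : Op) (e f : Term)

/-- The value of a term. -/
def Term.val (s : State) : Term → ℕ
  | .lit k => k
  | .var x => s.var x
  | .get a e => s.arr a (e.val s)
  | .bin o e f => o.val (e.val s) (f.val s)

/-- The number of steps needed to evaluate a term: one for each literal, register access,
array access and operation. -/
def Term.cost : Term → ℕ
  | .lit _ => 1
  | .var _ => 1
  | .get _ e => e.cost + 1
  | .bin _ e f => e.cost + f.cost + 1

/-- All numbers that occur in the evaluation of a term are smaller than `W`. -/
def Term.Fits (W : ℕ) (s : State) : Term → Prop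
  | .lit k => k < W
  | .var x => s.var x < W
  | .get a e => e.Fits W s ∧ s.arr a (e.val s) < W
  | .bin o e f => e.Fits W s ∧ f.Fits W s ∧ o.val (e.val s) (f.val s) < W

/-- Programs: do nothing; write `e` to register `x`; write `e` to cell `i` of array `a`;
sequential composition; branching on whether `e` is nonzero; `p` repeated while `e` is nonzero. -/
inductive Prog where
  | skip
  | set (x : ℕ) (e : Term)
  | put (a : ℕ) (i e : Term)
  | seq (p q : Prog)
  | ite (e : Term) (p q : Prog)
  | loop (e : Term) (p : Prog)

/-- The state after writing `k` to register `x`. -/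
def State.setVar (s : State) (x k : ℕ) : State :=
  { s with var := Function.update s.var x k }

/-- The state after writing `k` to cell `i` of array `a`. -/
def State.setArr (s : State) (a i k : ℕ) : State :=
  { s with arr := Function.update s.arr a (Function.update (s.arr a) i k) }

/-- `Run W p s t s'`: started in state `s`, the program `p` halts after exactly `t` steps in
state `s'`, and all numbers that occur in the run are smaller than `W`. -/
inductive Run (W : ℕ) : Prog → State → ℕ → State → Prop where
  | skip (s : State) : Run W .skip s 1 s
  | set (s : State) (x : ℕ) (e : Term) (he : e.Fits W s) :
      Run W (.set x e) s (e.cost + 1) (s.setVar x (e.val s))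
  | put (s : State) (a : ℕ) (i e : Term) (hi : i.Fits W s) (he : e.Fits W s) :
      Run W (.put a i e) s (i.cost + e.cost + 1) (s.setArr a (i.val s) (e.val s))
  | seq {p q : Prog} {s s₁ s₂ : State} {t₁ t₂ : ℕ}
      (hp : Run W p s t₁ s₁) (hq : Run W q s₁ t₂ s₂) : Run W (.seq p q) s (t₁ + t₂) s₂
  | iteTrue {e : Term} {p q : Prog} {s s₁ : State} {t : ℕ} (he : e.Fits W s)
      (h : e.val s ≠ 0) (hp : Run W p s t s₁) : Run W (.ite e p q) s (e.cost + 1 + t) s₁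
  | iteFalse {e : Term} {p q : Prog} {s s₁ : State} {t : ℕ} (he : e.Fits W s)
      (h : e.val s = 0) (hq : Run W q s t s₁) : Run W (.ite e p q) s (e.cost + 1 + t) s₁
  | loopTrue {e : Term} {p : Prog} {s s₁ s₂ : State} {t₁ t₂ : ℕ} (he : e.Fits W s)
      (h : e.val s ≠ 0) (hp : Run W p s t₁ s₁) (hl : Run W (.loop e p) s₁ t₂ s₂) :
      Run W (.loop e p) s (e.cost + 1 + t₁ + t₂) s₂
  | loopFalse {e : Term} {p : Prog} {s : State} (he : e.Fits W s) (h : e.val s = 0) :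
      Run W (.loop e p) s (e.cost + 1) s

/-- Programs are deterministic. -/
theorem Run.unique {W : ℕ} {p : Prog} {s s₁ s₂ : State} {t₁ t₂ : ℕ}
    (h₁ : Run W p s t₁ s₁) (h₂ : Run W p s t₂ s₂) : t₁ = t₂ ∧ s₁ = s₂ := by
  induction h₁ generalizing t₂ s₂ with
  | skip s => cases h₂; exact ⟨rfl, rfl⟩
  | set => cases h₂; exact ⟨rfl, rfl⟩
  | put => cases h₂; exact ⟨rfl, rfl⟩
  | seq hp hq ihp ihq =>
    cases h₂ with
    | seq hp' hq' =>
      obtain ⟨rfl, rfl⟩ := ihp hp'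
      obtain ⟨rfl, rfl⟩ := ihq hq'
      exact ⟨rfl, rfl⟩
  | iteTrue he h hp ih =>
    cases h₂ with
    | iteTrue _ _ hp' => obtain ⟨rfl, rfl⟩ := ih hp'; exact ⟨rfl, rfl⟩
    | iteFalse _ h' _ => exact absurd h' h
  | iteFalse he h hp ih =>
    cases h₂ with
    | iteTrue _ h' _ => exact absurd h h'
    | iteFalse _ _ hp' => obtain ⟨rfl, rfl⟩ := ih hp'; exact ⟨rfl, rfl⟩
  | loopTrue he h hp hl ihp ihl =>
    cases h₂ with
    | loopTrue _ _ hp' hl' =>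
      obtain ⟨rfl, rfl⟩ := ihp hp'
      obtain ⟨rfl, rfl⟩ := ihl hl'
      exact ⟨rfl, rfl⟩
    | loopFalse _ h' => exact absurd h' h
  | loopFalse he h =>
    cases h₂ with
    | loopTrue _ h' _ _ => exact absurd h h'
    | loopFalse _ _ => exact ⟨rfl, rfl⟩

end Ram

/-! ### The input -/

/-- `off` and `adj` represent the graph `G` with vertices `0, ..., n - 1` by adjacency lists:
the list of `v` occupies the cells `off v, ..., off (v + 1) - 1` of `adj`, and contains every
neighbour of `v` exactly once, in any order. -/
structure IsAdjList {n : ℕ} (G : SimpleGraph (Fin n)) (off adj : ℕ → ℕ) : Prop where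
  zero : off 0 = 0
  mono : ∀ v : Fin n, off v ≤ off (v + 1)
  bijOn : ∀ v : Fin n,
    Set.BijOn adj (Set.Ico (off v) (off (v + 1))) (Fin.val '' G.neighborSet v)

/-- The initial state: register `0` contains the number `n` of vertices, arrays `0` and `1` contain
the adjacency lists, and arrays `2` and `3` the characteristic vectors of `X` and `Y`.
Everything else is `0`. -/
def initState {n : ℕ} (off adj : ℕ → ℕ) (X Y : Finset (Fin n)) : Ram.State where
  var := fun x => if x = 0 then n else 0
  arr := fun a i => match a with
    | 0 => off i
    | 1 => adj i
    | 2 => if i ∈ X.image Fin.val then 1 else 0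
    | 3 => if i ∈ Y.image Fin.val then 1 else 0
    | _ => 0

/-! ### Cycles of lengths 6 and 7 -/

/-! If a side of B is empty, a maximal independent extension of the other side is a witness
(`isGenerating_of_eq_empty`). Otherwise a witness S lies outside the closed neighbourhood of B.
Vertices with neighbours on both sides are dominated anyway, and far vertices are handled by taking
S maximal among them. What remains is to dominate the set D of vertices outside B with neighbours on
exactly one side, using an independent subset of the set A of far vertices that have a neighbour in
D (`isGenerating_iff`).

Let the anchors of a vertex of D be its neighbours in B. Without 6- and 7-cycles, vertices of D seen
from the two ends of an edge of A have the same anchors, and so do the vertices of D seen from one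
non-isolated vertex of A. A common anchor would close many paths through A and D into a 6- or
7-cycle, which excludes those paths (`twinStructure_outerVertices`, `crossFree_outerVertices`).

First consequence: two neighbours in A of one vertex of A both have the same single neighbour in D,
and one of them may be deleted (`TwinStructure.hasIndepDominating_erase`). So A may be assumed to
induce a matching with isolated vertices.

Second consequence: a greedy choice works. A vertex dominating everything in D that its partner
dominates may be selected. If no such vertex exists, partners have disjoint nonempty neighbourhoods
in D. Then a vertex d of D with at most one sole neighbour (a neighbour in A whose only neighbour in
D is d), but with some neighbour in A, forces a particular vertex into every solution
(`IsCritical.mem_of_dominating`). When neither rule applies and every vertex of D has a neighbour in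
A, each has at least two sole neighbours. A matching edge contains at most two of these, so Hall's
theorem assigns distinct edges to the vertices of D and a solution exists
(`MatchingInstance.hasIndepDominating_of_terminal`).

Each selection shrinks A, so n rounds of O(n²) steps on an adjacency matrix suffice. The total O(n³)
is within the claimed bound. The second half of the file proves this for an explicit program, with a
Hoare-style predicate `Ram.Ex` that tracks time, frame conditions and word size. -/

theorem SimpleGraph.Free.not_hexagon {V : Type*} {G : SimpleGraph V}
    (hG : (SimpleGraph.cycleGraph 6).Free G) {p q r s t u : V}
    (hnd : [p, q, r, s, t, u].Nodup) (h₁ : G.Adj p q) (h₂ : G.Adj q r) (h₃ : G.Adj r s)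
    (h₄ : G.Adj s t) (h₅ : G.Adj t u) (h₆ : G.Adj u p) : False := by
  refine hG ⟨⟨⟨![p, q, r, s, t, u], ?_⟩, ?_⟩⟩
  · intro i j hij
    rw [SimpleGraph.cycleGraph_adj] at hij
    -- Non-adjacent index pairs contradict `hij`; the others are the given edges in one of the two
    -- directions.
    fin_cases i <;> fin_cases j <;> first
      | (exfalso; revert hij; decide)
      | assumption
      | (apply SimpleGraph.Adj.symm; assumption)
  · have := List.nodup_iff_injective_get.1 hnd
    intro i j hij
    apply this
    fin_cases i <;> fin_cases j <;> exact hij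

theorem SimpleGraph.Free.not_heptagon {V : Type*} {G : SimpleGraph V}
    (hG : (SimpleGraph.cycleGraph 7).Free G) {p q r s t u w : V}
    (hnd : [p, q, r, s, t, u, w].Nodup) (h₁ : G.Adj p q) (h₂ : G.Adj q r) (h₃ : G.Adj r s)
    (h₄ : G.Adj s t) (h₅ : G.Adj t u) (h₆ : G.Adj u w) (h₇ : G.Adj w p) : False := by
  refine hG ⟨⟨⟨![p, q, r, s, t, u, w], ?_⟩, ?_⟩⟩
  · intro i j hij
    rw [SimpleGraph.cycleGraph_adj] at hij
    fin_cases i <;> fin_cases j <;> first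
      | (exfalso; revert hij; decide)
      | assumption
      | (apply SimpleGraph.Adj.symm; assumption)
  · have := List.nodup_iff_injective_get.1 hnd
    intro i j hij
    apply this
    fin_cases i <;> fin_cases j <;> exact hij

/-! ### Vertices near a complete bipartite subgraph -/

/-- `d` is a vertex outside `P ∪ Q` with a neighbour in `P` and none in `Q`. -/
structure AttachedTo {V : Type*} (G : SimpleGraph V) (P Q : Set V) (d : V) : Prop where
  notMem_left : d ∉ P
  notMem_right : d ∉ Q
  exists_adj : ∃ x ∈ P, G.Adj d x
  not_adj : ∀ y ∈ Q, ¬ G.Adj d y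

/-- `v` lies outside the closed neighbourhood of `P ∪ Q`. -/
structure FarFrom {V : Type*} (G : SimpleGraph V) (P Q : Set V) (v : V) : Prop where
  notMem_left : v ∉ P
  notMem_right : v ∉ Q
  not_adj_left : ∀ x ∈ P, ¬ G.Adj v x
  not_adj_right : ∀ y ∈ Q, ¬ G.Adj v y

section Near

variable {V : Type*} {G : SimpleGraph V} {P Q : Set V}

theorem FarFrom.swap {v : V} (h : FarFrom G P Q v) : FarFrom G Q P v :=
  ⟨h.2, h.1, h.4, h.3⟩

theorem FarFrom.ne_attachedTo {v d : V} (h : FarFrom G P Q v) (hd : AttachedTo G P Q d) :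
    v ≠ d := by
  rintro rfl
  obtain ⟨x, hx, hdx⟩ := hd.exists_adj
  exact h.not_adj_left x hx hdx

theorem IsInducedCompleteBipartite.swap (h : IsInducedCompleteBipartite G P Q) :
    IsInducedCompleteBipartite G Q P :=
  ⟨h.disjoint.symm, h.indepY, h.indepX, fun y hy x hx => (h.adj x hx y hy).symm⟩

/-- With anchors x of a and y of c on opposite sides, x and y are adjacent and `a x y c w v` is a
hexagon. -/
theorem no_crossing_edge (h6 : (SimpleGraph.cycleGraph 6).Free G)
    (hB : IsInducedCompleteBipartite G P Q) {v w a c : V} (hv : FarFrom G P Q v)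
    (hw : FarFrom G P Q w) (hvw : G.Adj v w) (ha : AttachedTo G P Q a) (hc : AttachedTo G Q P c)
    (hva : G.Adj v a) (hwc : G.Adj w c) : False := by
  obtain ⟨x, hx, hax⟩ := ha.exists_adj
  obtain ⟨y, hy, hcy⟩ := hc.exists_adj
  have hxy := hB.adj x hx y hy
  have hac : a ≠ c := by rintro rfl; exact ha.not_adj y hy hcy
  refine h6.not_hexagon (p := a) (q := x) (r := y) (s := c) (t := w) (u := v) ?_ hax hxy hcy.symm
    hwc.symm hvw.symm hva
  have h1 := hw.ne_attachedTo ha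
  have h2 := hw.swap.ne_attachedTo hc
  have h3 := hv.ne_attachedTo ha
  have h4 := hv.swap.ne_attachedTo hc
  have := ha.1; have := ha.2; have := hc.1; have := hc.2
  have := hv.1; have := hv.2; have := hw.1; have := hw.2
  have := hvw.ne; have := hxy.ne
  simp only [List.nodup_cons, List.mem_cons, List.not_mem_nil, not_or, or_false]
  grind

/-- Two different anchors on one side have a common neighbour y on the other, which gives the
hexagon `x a v b x' y`. -/
theorem anchor_eq_of_common_adj (h6 : (SimpleGraph.cycleGraph 6).Free G)
    (hB : IsInducedCompleteBipartite G P Q) (hQ : Q.Nonempty) {v a b x x' : V}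
    (hv : FarFrom G P Q v) (ha : AttachedTo G P Q a) (hb : AttachedTo G P Q b) (hab : a ≠ b)
    (hva : G.Adj v a) (hvb : G.Adj v b) (hx : x ∈ P) (hx' : x' ∈ P) (hax : G.Adj a x)
    (hbx : G.Adj b x') : x = x' := by
  by_contra hne
  obtain ⟨y, hy⟩ := hQ
  have hxy := hB.adj x hx y hy
  have hxy' := hB.adj x' hx' y hy
  refine h6.not_hexagon (p := x) (q := a) (r := v) (s := b) (t := x') (u := y) ?_ hax.symm hva.symm
    hvb hbx hxy' hxy.symm
  have h3 := hv.ne_attachedTo ha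
  have h4 := hv.ne_attachedTo hb
  have := ha.1; have := ha.2; have := hb.1; have := hb.2
  have := hv.1; have := hv.2
  have := hxy.ne; have := hxy'.ne
  simp only [List.nodup_cons, List.mem_cons, List.not_mem_nil, not_or, or_false]
  grind

/-- Different anchors would give the heptagon `x a v w b x' y`, with y any vertex of the other side.
-/
theorem anchor_eq_of_adj (h7 : (SimpleGraph.cycleGraph 7).Free G)
    (hB : IsInducedCompleteBipartite G P Q) (hQ : Q.Nonempty) {v w a b x x' : V}
    (hv : FarFrom G P Q v) (hw : FarFrom G P Q w) (hvw : G.Adj v w) (ha : AttachedTo G P Q a)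
    (hb : AttachedTo G P Q b) (hab : a ≠ b) (hva : G.Adj v a) (hwb : G.Adj w b) (hx : x ∈ P)
    (hx' : x' ∈ P) (hax : G.Adj a x) (hbx : G.Adj b x') : x = x' := by
  by_contra hne
  obtain ⟨y, hy⟩ := hQ
  have hxy := hB.adj x hx y hy
  have hxy' := hB.adj x' hx' y hy
  refine h7.not_heptagon (p := x) (q := a) (r := v) (s := w) (t := b) (u := x') (w := y) ?_ hax.symm
    hva.symm hvw hwb hbx hxy' hxy.symm
  have h1 := hw.ne_attachedTo ha
  have h2 := hw.ne_attachedTo hb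
  have h3 := hv.ne_attachedTo ha
  have h4 := hv.ne_attachedTo hb
  have := ha.1; have := ha.2; have := hb.1; have := hb.2
  have := hv.1; have := hv.2; have := hw.1; have := hw.2
  have := hxy.ne; have := hxy'.ne; have := hvw.ne
  simp only [List.nodup_cons, List.mem_cons, List.not_mem_nil, not_or, or_false]
  and_intros <;> grind

/-- The neighbours of `d` in `P ∪ Q`. -/
def anchors (G : SimpleGraph V) (P Q : Set V) (d : V) : Set V :=
  {x | (x ∈ P ∨ x ∈ Q) ∧ G.Adj d x}

theorem anchors_swap (d : V) : anchors G P Q d = anchors G Q P d := by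
  ext x; simp [anchors, or_comm]

theorem AttachedTo.mem_anchors {d x : V} (hd : AttachedTo G P Q d) :
    x ∈ anchors G P Q d ↔ x ∈ P ∧ G.Adj d x := by
  have := hd.not_adj
  simp only [anchors, Set.mem_ofPred_eq]
  grind

/-- Both anchor sets are nonempty and every element of one equals every element of the other, so
they are the same singleton. -/
theorem AttachedTo.anchors_eq {a b : V} (ha : AttachedTo G P Q a) (hb : AttachedTo G P Q b)
    (h : ∀ x ∈ P, ∀ x' ∈ P, G.Adj a x → G.Adj b x' → x = x') :
    anchors G P Q a = anchors G P Q b := by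
  ext z
  rw [ha.mem_anchors, hb.mem_anchors]
  obtain ⟨x, hx, hax⟩ := ha.exists_adj
  obtain ⟨x', hx', hbx⟩ := hb.exists_adj
  grind

/-- Opposite sides are excluded by a hexagon, different anchors on the same side by a heptagon. -/
theorem anchors_eq_of_adj (h6 : (SimpleGraph.cycleGraph 6).Free G)
    (h7 : (SimpleGraph.cycleGraph 7).Free G) (hB : IsInducedCompleteBipartite G P Q)
    (hP : P.Nonempty) (hQ : Q.Nonempty) {v w a b : V} (hv : FarFrom G P Q v)
    (hw : FarFrom G P Q w) (hvw : G.Adj v w) (ha : AttachedTo G P Q a ∨ AttachedTo G Q P a)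
    (hb : AttachedTo G P Q b ∨ AttachedTo G Q P b) (hva : G.Adj v a) (hwb : G.Adj w b) :
    anchors G P Q a = anchors G P Q b := by
  by_cases hab : a = b
  · rw [hab]
  rcases ha with ha | ha <;> rcases hb with hb | hb
  · exact ha.anchors_eq hb fun x hx x' hx' hax hbx =>
      anchor_eq_of_adj h7 hB hQ hv hw hvw ha hb hab hva hwb hx hx' hax hbx
  · exact (no_crossing_edge h6 hB hv hw hvw ha hb hva hwb).elim
  · exact (no_crossing_edge h6 hB hw hv hvw.symm hb ha hwb hva).elim
  · rw [anchors_swap a, anchors_swap b]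
    exact ha.anchors_eq hb fun x hx x' hx' hax hbx =>
      anchor_eq_of_adj h7 hB.swap hP hv.swap hw.swap hvw ha hb hab hva hwb hx hx' hax hbx

/-- The neighbour w of v and its attached vertex e are needed only to exclude that a and b are
attached to opposite sides. -/
theorem anchors_eq_of_common_adj (h6 : (SimpleGraph.cycleGraph 6).Free G)
    (hB : IsInducedCompleteBipartite G P Q)
    (hP : P.Nonempty) (hQ : Q.Nonempty) {v w a b e : V} (hv : FarFrom G P Q v)
    (hw : FarFrom G P Q w) (hvw : G.Adj v w) (ha : AttachedTo G P Q a ∨ AttachedTo G Q P a)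
    (hb : AttachedTo G P Q b ∨ AttachedTo G Q P b) (he : AttachedTo G P Q e ∨ AttachedTo G Q P e)
    (hva : G.Adj v a) (hvb : G.Adj v b) (hwe : G.Adj w e) :
    anchors G P Q a = anchors G P Q b := by
  by_cases hab : a = b
  · rw [hab]
  -- Whichever side e is attached to, one of a and b is attached to the other, and with e it crosses
  -- the edge vw.
  have key : ∀ {a b : V}, G.Adj v a → G.Adj v b → AttachedTo G P Q a → AttachedTo G Q P b →
      False := by
    intro a b hva hvb ha hb
    rcases he with he | he
    · exact no_crossing_edge h6 hB hw hv hvw.symm he hb hwe hvb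
    · exact no_crossing_edge h6 hB hv hw hvw ha he hva hwe
  rcases ha with ha | ha <;> rcases hb with hb | hb
  · exact ha.anchors_eq hb fun x hx x' hx' hax hbx =>
      anchor_eq_of_common_adj h6 hB hQ hv ha hb hab hva hvb hx hx' hax hbx
  · exact (key hva hvb ha hb).elim
  · exact (key hvb hva hb ha).elim
  · rw [anchors_swap a, anchors_swap b]
    exact ha.anchors_eq hb fun x hx x' hx' hax hbx =>
      anchor_eq_of_common_adj h6 hB.swap hP hv.swap ha hb hab hva hvb hx hx' hax hbx

/-- Supplies the vertex of the bipartite subgraph that closes the forbidden cycles below. -/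
theorem exists_common_anchor {a c : V} (ha : AttachedTo G P Q a ∨ AttachedTo G Q P a)
    (h : anchors G P Q a = anchors G P Q c) :
    ∃ x, (x ∈ P ∨ x ∈ Q) ∧ G.Adj a x ∧ G.Adj c x := by
  have : ∃ x, x ∈ anchors G P Q a := by
    rcases ha with ha | ha <;> obtain ⟨x, hx, hax⟩ := ha.exists_adj
    exacts [⟨x, .inl hx, hax⟩, ⟨x, .inr hx, hax⟩]
  obtain ⟨x, hx⟩ := this
  have hx' := h ▸ hx
  exact ⟨x, hx.1, hx.2, hx'.2⟩

theorem FarFrom.ne {v x : V} (hv : FarFrom G P Q v) (hx : x ∈ P ∨ x ∈ Q) : v ≠ x := by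
  rintro rfl
  exact hx.elim hv.1 hv.2

end Near

/-! ### Independent sets that dominate a given set -/

/-- Some independent subset of `A` dominates `D`. -/
def HasIndepDominating {V : Type*} (G : SimpleGraph V) (A D : Finset V) : Prop :=
  ∃ S : Finset V, S ⊆ A ∧ G.IsIndepSet (S : Set V) ∧ ∀ d ∈ D, ∃ v ∈ S, G.Adj v d

/-- The part of the structure of `A` and `D` that is used to delete twins in `A`. -/
structure TwinStructure {V : Type*} (G : SimpleGraph V) (A D : Finset V) : Prop where
  exists_adj : ∀ v ∈ A, ∃ d ∈ D, G.Adj v d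
  eq_of_path_three : ∀ w ∈ A, ∀ v ∈ A, ∀ u ∈ A, w ≠ u → G.Adj w v → G.Adj v u →
    ∀ a ∈ D, ∀ c ∈ D, G.Adj w a → G.Adj u c → a = c
  eq_of_path_four : ∀ t ∈ A, ∀ u ∈ A, ∀ v ∈ A, ∀ w ∈ A, t ≠ v → t ≠ w → u ≠ w → G.Adj t u →
    G.Adj u v → G.Adj v w → ∀ a ∈ D, ∀ c ∈ D, G.Adj t a → G.Adj w c → a = c

/-- Paths `a v b w c` and `a v b w u c` whose vertices lie in `D` (`a`, `b`, `c`) and in `A`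
(`v`, `w`, `u`, none of them isolated in `A`) do not exist. -/
structure CrossFree {V : Type*} (G : SimpleGraph V) (A D : Finset V) : Prop where
  no_path_five : ∀ v ∈ A, ∀ w ∈ A, (∃ v' ∈ A, G.Adj v v') → (∃ w' ∈ A, G.Adj w w') → v ≠ w →
    ∀ a ∈ D, ∀ b ∈ D, ∀ c ∈ D, a ≠ b → b ≠ c → a ≠ c →
    G.Adj v a → G.Adj v b → G.Adj w b → ¬ G.Adj w c
  no_path_six : ∀ v ∈ A, ∀ w ∈ A, ∀ u ∈ A, (∃ v' ∈ A, G.Adj v v') → v ≠ w → v ≠ u → G.Adj w u →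
    ∀ a ∈ D, ∀ b ∈ D, ∀ c ∈ D, a ≠ b → b ≠ c → a ≠ c →
    G.Adj v a → G.Adj v b → G.Adj w b → ¬ G.Adj u c

/-- `G` induces a matching on `A`, together with isolated vertices. -/
def InducesMatching {V : Type*} (G : SimpleGraph V) (A : Finset V) : Prop :=
  ∀ v ∈ A, ∀ w ∈ A, ∀ u ∈ A, G.Adj v w → G.Adj v u → w = u

section Domination

variable {V : Type*} {G : SimpleGraph V} {A A' D D' : Finset V}

theorem HasIndepDominating.mono (h : HasIndepDominating G A D) (hA : A ⊆ A') (hD : D' ⊆ D) :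
    HasIndepDominating G A' D' :=
  h.imp fun _ hS => ⟨hS.1.trans hA, hS.2.1, fun d hd => hS.2.2 d (hD hd)⟩

theorem CrossFree.mono (h : CrossFree G A D) (hA : A' ⊆ A) (hD : D' ⊆ D) : CrossFree G A' D' where
  no_path_five v hv w hw hv' hw' hne a ha b hb c hc :=
    h.no_path_five v (hA hv) w (hA hw) (hv'.imp fun _ h => ⟨hA h.1, h.2⟩)
      (hw'.imp fun _ h => ⟨hA h.1, h.2⟩) hne a (hD ha) b (hD hb) c (hD hc)
  no_path_six v hv w hw u hu hv' hne hne' hwu a ha b hb c hc :=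
    h.no_path_six v (hA hv) w (hA hw) u (hA hu) (hv'.imp fun _ h => ⟨hA h.1, h.2⟩)
      hne hne' hwu a (hD ha) b (hD hb) c (hD hc)

theorem InducesMatching.mono (h : InducesMatching G A) (hA : A' ⊆ A) : InducesMatching G A' :=
  fun v hv w hw u hu => h v (hA hv) w (hA hw) u (hA hu)

/-- Only A may shrink: `exists_adj` asserts the existence of neighbours in D. -/
theorem TwinStructure.mono (h : TwinStructure G A D) (hA : A' ⊆ A) : TwinStructure G A' D where
  exists_adj v hv := h.exists_adj v (hA hv)
  eq_of_path_three w hw v hv u hu := h.eq_of_path_three w (hA hw) v (hA hv) u (hA hu)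
  eq_of_path_four t ht u hu v hv w hw :=
    h.eq_of_path_four t (hA ht) u (hA hu) v (hA hv) w (hA hw)

/-! ### Deleting twins -/

theorem isIndepSet_insert_erase [DecidableEq V] {S : Finset V} {v w : V}
    (hS : G.IsIndepSet (S : Set V)) (h : ∀ u ∈ S, u ≠ v → ¬ G.Adj w u) :
    G.IsIndepSet ((insert w (S.erase v) : Finset V) : Set V) := by
  intro x hx y hy hxy hadj
  simp only [Finset.coe_insert, Finset.coe_erase, Set.mem_insert_iff, Set.mem_sdiff,
    Finset.mem_coe, Set.mem_singleton_iff] at hx hy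
  rcases hx with rfl | ⟨hx, hxv⟩ <;> rcases hy with rfl | ⟨hy, hyv⟩
  · exact hxy rfl
  · exact h y hy hyv hadj
  · exact h x hx hxv hadj.symm
  · exact hS hx hy hxy hadj

/-- By `eq_of_path_three`, w and w' see the same single vertex a of D. In a solution using w',
either another vertex dominates a and w' is dropped, or w replaces w'. -/
theorem TwinStructure.hasIndepDominating_erase [DecidableEq V] (h : TwinStructure G A D)
    {v w w' : V} (hv : v ∈ A) (hw : w ∈ A) (hw' : w' ∈ A) (hne : w ≠ w') (hvw : G.Adj v w)
    (hvw' : G.Adj v w') :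
    HasIndepDominating G (A.erase w') D ↔ HasIndepDominating G A D := by
  refine ⟨fun hd => hd.mono (Finset.erase_subset _ _) subset_rfl, ?_⟩
  rintro ⟨S, hSA, hS, hdom⟩
  by_cases hmem : w' ∈ S
  swap
  · exact ⟨S, fun x hx => Finset.mem_erase.2 ⟨fun h => hmem (h ▸ hx), hSA hx⟩, hS, hdom⟩
  have hvS : v ∉ S := fun hvS => hS hvS hmem hvw'.ne hvw'
  obtain ⟨a, ha, hwa⟩ := h.exists_adj w hw
  have huniq : ∀ d ∈ D, G.Adj w' d → d = a := fun d hd hd' =>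
    (h.eq_of_path_three w hw v hv w' hw' hne hvw.symm hvw' a ha d hd hwa hd').symm
  by_cases hdom' : ∃ u ∈ S, u ≠ w' ∧ G.Adj u a
  · obtain ⟨u, hu, huw, hua⟩ := hdom'
    refine ⟨S.erase w', Finset.erase_subset_erase _ hSA, hS.mono (by simp), fun d hd => ?_⟩
    obtain ⟨x, hx, hxd⟩ := hdom d hd
    by_cases hxw : x = w'
    · subst hxw
      rw [huniq d hd hxd]
      exact ⟨u, Finset.mem_erase.2 ⟨huw, hu⟩, hua⟩
    · exact ⟨x, Finset.mem_erase.2 ⟨hxw, hx⟩, hxd⟩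
  · push Not at hdom'
    refine ⟨insert w (S.erase w'), ?_, isIndepSet_insert_erase hS fun u hu huw hwu => ?_,
      fun d hd => ?_⟩
    · intro x hx
      rcases Finset.mem_insert.1 hx with rfl | hx
      · exact Finset.mem_erase.2 ⟨hne, hw⟩
      · exact Finset.erase_subset_erase _ hSA hx
    -- A neighbour u of w in S would start the path `u w v w'`; then u dominates a, contrary to
    -- `hdom'`.
    · obtain ⟨c, hc, huc⟩ := h.exists_adj u (hSA hu)
      obtain ⟨e, he, hwe⟩ := h.exists_adj w' hw'
      obtain rfl := huniq e he hwe
      have := h.eq_of_path_four u (hSA hu) w hw v hv w' hw' (fun h => hvS (h ▸ hu)) huw hne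
        hwu.symm hvw.symm hvw' c hc e he huc hwe
      exact hdom' u hu huw (this ▸ huc)
    · obtain ⟨x, hx, hxd⟩ := hdom d hd
      by_cases hxw : x = w'
      · subst hxw
        rw [huniq d hd hxd]
        exact ⟨w, Finset.mem_insert_self _ _, hwa⟩
      · exact ⟨x, Finset.mem_insert_of_mem (Finset.mem_erase.2 ⟨hxw, hx⟩), hxd⟩

/-- What is left of `A` after `c` is put into the independent set. -/
def restA [DecidableEq V] (G : SimpleGraph V) [DecidableRel G.Adj] (A : Finset V) (c : V) :
    Finset V :=
  A.filter fun v => v ≠ c ∧ ¬ G.Adj c v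

/-- What is left of `D` after `c` is put into the independent set. -/
def restD (G : SimpleGraph V) [DecidableRel G.Adj] (D : Finset V) (c : V) : Finset V :=
  D.filter fun d => ¬ G.Adj c d

set_option linter.unusedSectionVars false

variable [DecidableEq V] [DecidableRel G.Adj]

theorem mem_restA {c v : V} : v ∈ restA G A c ↔ v ∈ A ∧ v ≠ c ∧ ¬ G.Adj c v := by
  simp [restA]

theorem mem_restD {c d : V} : d ∈ restD G D c ↔ d ∈ D ∧ ¬ G.Adj c d := by
  simp [restD]

theorem restA_subset (c : V) : restA G A c ⊆ A := Finset.filter_subset _ _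

theorem restD_subset (c : V) : restD G D c ⊆ D := Finset.filter_subset _ _

theorem card_restA_lt {c : V} (hc : c ∈ A) : (restA G A c).card < A.card :=
  Finset.card_lt_card (Finset.filter_ssubset.2 ⟨c, hc, by simp⟩)

theorem HasIndepDominating.of_rest {c : V} (hc : c ∈ A)
    (h : HasIndepDominating G (restA G A c) (restD G D c)) : HasIndepDominating G A D := by
  obtain ⟨S, hSA, hS, hdom⟩ := h
  refine ⟨insert c S, ?_, ?_, fun d hd => ?_⟩
  · exact Finset.insert_subset hc (hSA.trans (restA_subset c))
  · rw [Finset.coe_insert]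
    intro x hx y hy hxy hadj
    rcases hx with rfl | hx <;> rcases hy with rfl | hy
    · exact hxy rfl
    · exact (mem_restA.1 (hSA hy)).2.2 hadj
    · exact (mem_restA.1 (hSA hx)).2.2 hadj.symm
    · exact hS hx hy hxy hadj
  · by_cases hcd : G.Adj c d
    · exact ⟨c, Finset.mem_insert_self _ _, hcd⟩
    · obtain ⟨v, hv, hvd⟩ := hdom d (mem_restD.2 ⟨hd, hcd⟩)
      exact ⟨v, Finset.mem_insert_of_mem hv, hvd⟩

/-- `v` dominates every vertex of `D` that its neighbours in `A` dominate. -/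
def IsDominant (G : SimpleGraph V) (A D : Finset V) (v : V) : Prop :=
  v ∈ A ∧ ∀ w ∈ A, G.Adj v w → ∀ d ∈ D, G.Adj w d → G.Adj v d

/-- Removing v and its neighbours from a solution costs only vertices of D that v dominates. -/
theorem IsDominant.hasIndepDominating_rest {v : V} (hv : IsDominant G A D v)
    (h : HasIndepDominating G A D) : HasIndepDominating G (restA G A v) (restD G D v) := by
  obtain ⟨S, hSA, hS, hdom⟩ := h
  refine ⟨restA G S v, fun x hx => ?_, ?_, fun d hd => ?_⟩
  · obtain ⟨hx, hx'⟩ := mem_restA.1 hx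
    exact mem_restA.2 ⟨hSA hx, hx'⟩
  · exact hS.mono (Finset.coe_subset.2 (restA_subset v))
  · obtain ⟨hd, hvd⟩ := mem_restD.1 hd
    obtain ⟨x, hx, hxd⟩ := hdom d hd
    refine ⟨x, mem_restA.2 ⟨hx, ?_, fun h => ?_⟩, hxd⟩
    · rintro rfl
      exact hvd hxd
    · exact hvd (hv.2 x (hSA hx) h d hd hxd)

/-- A solution containing v avoids the neighbours of v, so removing v leaves a solution of the rest.
-/
theorem HasIndepDominating.rest_of_forced {v : V}
    (hv : ∀ S : Finset V, S ⊆ A → G.IsIndepSet (S : Set V) → (∀ d ∈ D, ∃ x ∈ S, G.Adj x d) → v ∈ S)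
    (h : HasIndepDominating G A D) : HasIndepDominating G (restA G A v) (restD G D v) := by
  obtain ⟨S, hSA, hS, hdom⟩ := h
  have hvS := hv S hSA hS hdom
  refine ⟨S.erase v, fun x hx => ?_, hS.mono (by simp), fun d hd => ?_⟩
  · obtain ⟨hxv, hx⟩ := Finset.mem_erase.1 hx
    exact mem_restA.2 ⟨hSA hx, hxv, fun h => hS hvS hx hxv.symm h⟩
  · obtain ⟨hd, hvd⟩ := mem_restD.1 hd
    obtain ⟨x, hx, hxd⟩ := hdom d hd
    refine ⟨x, Finset.mem_erase.2 ⟨?_, hx⟩, hxd⟩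
    rintro rfl
    exact hvd hxd

/-- The number of neighbours of `v` in `D`. -/
def degIn (G : SimpleGraph V) [DecidableRel G.Adj] (D : Finset V) (v : V) : ℕ :=
  (D.filter fun d => G.Adj v d).card

/-- The neighbours of `d` in `A` that have no other neighbours in `D`. -/
def soleNeighbors (G : SimpleGraph V) [DecidableRel G.Adj] (A D : Finset V) (d : V) : Finset V :=
  A.filter fun v => G.Adj d v ∧ degIn G D v = 1

theorem mem_soleNeighbors {d v : V} :
    v ∈ soleNeighbors G A D d ↔ v ∈ A ∧ G.Adj d v ∧ degIn G D v = 1 := by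
  simp [soleNeighbors]

theorem degIn_eq_one {d v : V} (hd : d ∈ D) (hvd : G.Adj v d) :
    degIn G D v = 1 ↔ ∀ e ∈ D, G.Adj v e → e = d := by
  rw [degIn, Finset.card_eq_one]
  constructor
  · rintro ⟨x, hx⟩ e he hve
    have h1 : e ∈ ({x} : Finset V) := hx ▸ Finset.mem_filter.2 ⟨he, hve⟩
    have h2 : d ∈ ({x} : Finset V) := hx ▸ Finset.mem_filter.2 ⟨hd, hvd⟩
    rw [Finset.mem_singleton.1 h1, Finset.mem_singleton.1 h2]
  · intro h
    refine ⟨d, Finset.ext fun e => ?_⟩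
    rw [Finset.mem_filter, Finset.mem_singleton]
    exact ⟨fun he => h e he.1 he.2, by rintro rfl; exact ⟨hd, hvd⟩⟩

/-- `v` is a neighbour of `d ∈ D`, has more than one neighbour in `D` if some neighbour of `d`
has, and `d` has at most one neighbour in `A` with exactly one neighbour in `D`. -/
def IsCritical (G : SimpleGraph V) [DecidableRel G.Adj] (A D : Finset V) (d v : V) : Prop :=
  d ∈ D ∧ v ∈ A ∧ G.Adj d v ∧ (soleNeighbors G A D d).card ≤ 1 ∧
    (degIn G D v ≤ 1 → ∀ w ∈ A, G.Adj d w → degIn G D w ≤ 1)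

/-- `A` induces a matching with isolated vertices, and `A` and `D` have no short crossing paths. -/
structure MatchingInstance (G : SimpleGraph V) (A D : Finset V) : Prop where
  matching : InducesMatching G A
  crossFree : CrossFree G A D

theorem MatchingInstance.mono (h : MatchingInstance G A D) (hA : A' ⊆ A) (hD : D' ⊆ D) :
    MatchingInstance G A' D' :=
  ⟨h.matching.mono hA, h.crossFree.mono hA hD⟩

/-! ### Forced vertices and the terminal case -/

theorem exists_partner (hdom : ∀ v, ¬ IsDominant G A D v) {v : V} (hv : v ∈ A) :
    ∃ w ∈ A, G.Adj v w ∧ ∃ d ∈ D, G.Adj w d ∧ ¬ G.Adj v d := by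
  have := hdom v
  simp only [IsDominant, not_and, not_forall] at this
  obtain ⟨w, hw, hvw, d, hd, hwd, hvd⟩ := this hv
  exact ⟨w, hw, hvw, d, hd, hwd, hvd⟩

/-- Neither partner is dominant, so each has a neighbour in D not shared with the other. A common
neighbour d would join these two by the forbidden path `c v d w a`. -/
theorem MatchingInstance.partners (h : MatchingInstance G A D) (hdom : ∀ v, ¬ IsDominant G A D v)
    {v w : V} (hv : v ∈ A) (hw : w ∈ A) (hvw : G.Adj v w) :
    (∃ d ∈ D, G.Adj w d) ∧ ∀ d ∈ D, G.Adj v d → ¬ G.Adj w d := by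
  obtain ⟨w', hw', hvw', a, ha, hwa, hva⟩ := exists_partner hdom hv
  obtain rfl := h.matching v hv w hw w' hw' hvw hvw'
  obtain ⟨v', hv', hwv', c, hc, hvc, hwc⟩ := exists_partner hdom hw
  obtain rfl := h.matching w hw v hv v' hv' hvw.symm hwv'
  refine ⟨⟨a, ha, hwa⟩, fun d hd hvd hwd => ?_⟩
  exact h.crossFree.no_path_five v hv w hw ⟨w, hw, hvw⟩ ⟨v, hv, hwv'⟩ hvw.ne c hc d hd a ha
    (by rintro rfl; exact hwc hwd) (by rintro rfl; exact hva hvd) (by rintro rfl; exact hwc hwa)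
    hvc hvd hwd hwa

/-- A neighbour `v` of `d` with a further neighbour `b` in `D` determines the neighbours in `D` of
each other neighbour `z` of `d` and of its partner `u`. -/
theorem MatchingInstance.other_neighbor (h : MatchingInstance G A D)
    (hdom : ∀ v, ¬ IsDominant G A D v) {d b v z : V} (hd : d ∈ D) (hb : b ∈ D) (hdb : d ≠ b)
    (hv : v ∈ A) (hz : z ∈ A) (hvz : v ≠ z) (hvd : G.Adj v d) (hvb : G.Adj v b) (hzd : G.Adj z d) :
    (∀ e ∈ D, G.Adj z e → e = d) ∧
      ∃ u ∈ A, G.Adj z u ∧ G.Adj u b ∧ ∀ e ∈ D, G.Adj u e → e = b := by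
  obtain ⟨u, hu, hzu, -⟩ := exists_partner hdom hz
  obtain ⟨v', hv', hvv', -⟩ := exists_partner hdom hv
  have hvu : v ≠ u := by
    rintro rfl
    exact (h.partners hdom hz hv hzu).2 d hd hzd hvd
  obtain ⟨⟨c, hc, huc⟩, hdisj⟩ := h.partners hdom hz hu hzu
  have hub : ∀ e ∈ D, G.Adj u e → e = b := by
    intro e he hue
    -- Otherwise `b v d z u e` is a forbidden path; `e ≠ d` because the partners z and u share no
    -- neighbour in D.
    by_contra heb
    refine h.crossFree.no_path_six v hv z hz u hu ⟨v', hv', hvv'⟩ hvz hvu hzu b hb d hd e he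
      hdb.symm ?_ (Ne.symm heb) hvb hvd hzd hue
    rintro rfl
    exact hdisj d hd hzd hue
  refine ⟨fun e he hze => ?_, u, hu, hzu, hub c hc huc ▸ huc, hub⟩
  by_contra hed
  refine h.crossFree.no_path_five v hv z hz ⟨v', hv', hvv'⟩ ⟨u, hu, hzu⟩ hvz b hb d hd e he
    hdb.symm (Ne.symm hed) ?_ hvb hvd hzd hze
  rintro rfl
  exact hdisj b hb hze (hub c hc huc ▸ huc)

theorem exists_second_neighbor {d v : V} (hd : d ∈ D) (hvd : G.Adj v d) (hdeg : degIn G D v ≠ 1) :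
    ∃ b ∈ D, d ≠ b ∧ G.Adj v b := by
  rw [Ne, degIn_eq_one hd hvd] at hdeg
  push Not at hdeg
  obtain ⟨b, hb, hvb, hne⟩ := hdeg
  exact ⟨b, hb, hne.symm, hvb⟩

theorem degIn_pos {d v : V} (hd : d ∈ D) (hvd : G.Adj v d) : 0 < degIn G D v :=
  Finset.card_pos.2 ⟨d, Finset.mem_filter.2 ⟨hd, hvd⟩⟩

/-- Suppose S avoids v and z in S dominates d. If d is the only neighbour of v in D, all neighbours
of d in A are sole neighbours, so z = v. Otherwise v has a second neighbour b, dominated by some y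
in S. Then z and the partner of y are sole neighbours of d, hence equal, and S contains two adjacent
vertices. -/
theorem IsCritical.mem_of_dominating (h : MatchingInstance G A D)
    (hdom : ∀ v, ¬ IsDominant G A D v) {d v : V} (hv : IsCritical G A D d v) (S : Finset V)
    (hSA : S ⊆ A) (hS : G.IsIndepSet (S : Set V)) (hSD : ∀ d ∈ D, ∃ x ∈ S, G.Adj x d) : v ∈ S := by
  obtain ⟨hd, hvA, hdv, hcard, hmax⟩ := hv
  have hsole := Finset.card_le_one.1 hcard
  by_contra hvS
  obtain ⟨z, hz, hzd⟩ := hSD d hd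
  have hvz : v ≠ z := by rintro rfl; exact hvS hz
  by_cases hdeg : degIn G D v = 1
  · have h1 := hmax hdeg.le z (hSA hz) hzd.symm
    have h2 := degIn_pos hd hzd
    exact hvz (hsole v (mem_soleNeighbors.2 ⟨hvA, hdv, hdeg⟩) z
      (mem_soleNeighbors.2 ⟨hSA hz, hzd.symm, by omega⟩))
  · obtain ⟨b, hb, hdb, hvb⟩ := exists_second_neighbor hd hdv.symm hdeg
    obtain ⟨y, hy, hyb⟩ := hSD b hb
    have hvy : v ≠ y := by rintro rfl; exact hvS hy
    obtain ⟨h1, -⟩ := h.other_neighbor hdom hd hb hdb hvA (hSA hz) hvz hdv.symm hvb hzd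
    obtain ⟨-, u, hu, hyu, hud, h2⟩ :=
      h.other_neighbor hdom hb hd hdb.symm hvA (hSA hy) hvy hvb hdv.symm hyb
    have : z = u := hsole z
      (mem_soleNeighbors.2 ⟨hSA hz, hzd.symm, (degIn_eq_one hd hzd).2 h1⟩) u
      (mem_soleNeighbors.2 ⟨hu, hud.symm, (degIn_eq_one hd hud).2 h2⟩)
    subst this
    exact hS hy hz hyu.ne hyu

/-- `c` may be put into the independent set. -/
def IsEligible (G : SimpleGraph V) [DecidableRel G.Adj] (A D : Finset V) (c : V) : Prop :=
  IsDominant G A D c ∨ (∀ v, ¬ IsDominant G A D v) ∧ ∃ d, IsCritical G A D d c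

theorem IsEligible.mem {c : V} (hc : IsEligible G A D c) : c ∈ A := by
  rcases hc with hc | ⟨-, d, hc⟩
  exacts [hc.1, hc.2.1]

/-- A dominant vertex is safe by exchange, a critical one because it is forced. -/
theorem IsEligible.hasIndepDominating_rest_iff (h : MatchingInstance G A D) {c : V}
    (hc : IsEligible G A D c) :
    HasIndepDominating G (restA G A c) (restD G D c) ↔ HasIndepDominating G A D := by
  refine ⟨HasIndepDominating.of_rest hc.mem, fun hS => ?_⟩
  rcases hc with hc | ⟨hdom, d, hc⟩
  · exact hc.hasIndepDominating_rest hS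
  · exact hS.rest_of_forced (hc.mem_of_dominating h hdom)

/-- With fewer than two sole neighbours, d would have a critical neighbour: one with several
neighbours in D if possible, any neighbour in A otherwise. -/
theorem two_le_card_soleNeighbors (hno : ∀ c, ¬ IsEligible G A D c) {d : V} (hd : d ∈ D)
    (hnbr : ∃ v ∈ A, G.Adj d v) : 2 ≤ (soleNeighbors G A D d).card := by
  by_contra hlt
  have hdom : ∀ v, ¬ IsDominant G A D v := fun v hv => hno v (.inl hv)
  have hno' : ∀ v, ¬ IsCritical G A D d v := fun v hv => hno v (.inr ⟨hdom, d, hv⟩)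
  obtain ⟨v, hv, hdv⟩ := hnbr
  by_cases hbig : ∃ w ∈ A, G.Adj d w ∧ ¬ degIn G D w ≤ 1
  · obtain ⟨w, hw, hdw, hdeg⟩ := hbig
    exact hno' w ⟨hd, hw, hdw, by omega, fun h => (hdeg h).elim⟩
  · push Not at hbig
    exact hno' v ⟨hd, hv, hdv, by omega, fun _ => hbig⟩

/-- Hall's theorem matches each vertex of D to a matching edge of A containing one of its sole
neighbours. Sole neighbours chosen from distinct edges are independent. -/
theorem MatchingInstance.hasIndepDominating_of_terminal (h : MatchingInstance G A D)
    (hno : ∀ c, ¬ IsEligible G A D c) (hnbr : ∀ d ∈ D, ∃ v ∈ A, G.Adj d v) :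
    HasIndepDominating G A D := by
  classical
  have hdom : ∀ v, ¬ IsDominant G A D v := fun v hv => hno v (.inl hv)
  have hpart : ∀ v : A, ∃ w : V, w ∈ A ∧ G.Adj v w := fun v =>
    (exists_partner hdom v.2).imp fun w hw => ⟨hw.1, hw.2.1⟩
  choose! p hpA hp using fun (v : V) (hv : v ∈ A) => hpart ⟨v, hv⟩
  have hpeq : ∀ v ∈ A, ∀ w ∈ A, G.Adj v w → p v = w := fun v hv w hw hvw =>
    h.matching v hv _ (hpA v hv) w hw (hp v hv) hvw
  let e : V → Finset V := fun v => {v, p v}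
  have hfib : ∀ v ∈ A, ∀ w ∈ A, e v = e w → w = v ∨ w = p v := by
    intro v hv w hw hvw
    have : w ∈ e v := hvw ▸ Finset.mem_insert_self _ _
    simpa [e] using this
  let t : D → Finset (Finset V) := fun d => (soleNeighbors G A D d).image e
  have hall : ∀ T : Finset D, T.card ≤ (T.biUnion t).card := by
    intro T
    let U := T.biUnion fun d => soleNeighbors G A D d
    have hU : T.biUnion t = U.image e := (Finset.biUnion_image ..).symm
    -- Sole neighbours of different vertices of D are different, so at least two per vertex of T add
    -- up.
    have h1 : T.card * 2 ≤ U.card := by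
      rw [Finset.card_biUnion]
      · exact Finset.card_nsmul_le_sum T (fun d : D => (soleNeighbors G A D (d : V)).card) 2
          fun d _ => two_le_card_soleNeighbors hno d.2 (hnbr d d.2)
      · intro d _ d' _ hdd'
        rw [Function.onFun, Finset.disjoint_left]
        intro v hv hv'
        obtain ⟨-, hdv, hdeg⟩ := mem_soleNeighbors.1 hv
        obtain ⟨-, hdv', -⟩ := mem_soleNeighbors.1 hv'
        exact hdd' (Subtype.ext ((degIn_eq_one d.2 hdv.symm).1 hdeg d' d'.2 hdv'.symm).symm)
    -- At most two vertices lie on the same matching edge, which exactly compensates the factor 2.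
    have h2 : U.card ≤ 2 * (U.image e).card := by
      have hUA : ∀ v ∈ U, v ∈ A := by
        intro v hv
        obtain ⟨d, -, hv⟩ := Finset.mem_biUnion.1 hv
        exact (mem_soleNeighbors.1 hv).1
      refine Finset.card_le_mul_card_image _ 2 fun b hb => ?_
      obtain ⟨v, hv, rfl⟩ := Finset.mem_image.1 hb
      refine (Finset.card_le_card (t := {v, p v}) fun w hw => ?_).trans Finset.card_le_two
      obtain ⟨hw, hwv⟩ := Finset.mem_filter.1 hw
      simpa using hfib v (hUA v hv) w (hUA w hw) hwv.symm
    rw [hU]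
    omega
  obtain ⟨f, hf, hft⟩ := (Finset.all_card_le_biUnion_card_iff_exists_injective t).1 hall
  have : ∀ d : D, ∃ v, v ∈ soleNeighbors G A D d ∧ e v = f d := fun d => by
    simpa [t] using hft d
  choose g hg hge using this
  have hgA : ∀ d, g d ∈ A := fun d => (mem_soleNeighbors.1 (hg d)).1
  refine ⟨Finset.univ.image g, ?_, ?_, fun d hd => ?_⟩
  · intro v hv
    obtain ⟨d, -, rfl⟩ := Finset.mem_image.1 hv
    exact hgA d
  · intro v hv w hw hvw hadj
    obtain ⟨d, -, rfl⟩ := Finset.mem_image.1 hv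
    obtain ⟨d', -, rfl⟩ := Finset.mem_image.1 hw
    have h1 := hpeq _ (hgA d) _ (hgA d') hadj
    have h2 := hpeq _ (hgA d') _ (hgA d) hadj.symm
    have : f d = f d' := by
      rw [← hge, ← hge]
      simp only [e, h1, h2]
      exact Finset.pair_comm _ _
    exact hvw (by rw [hf this])
  · exact ⟨g ⟨d, hd⟩, Finset.mem_image_of_mem _ (Finset.mem_univ _),
      (mem_soleNeighbors.1 (hg ⟨d, hd⟩)).2.1.symm⟩

end Domination

/-! ### Generating subgraphs and dominating independent sets -/

section Generating

variable {V : Type*} {G : SimpleGraph V}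

/-- A vertex of S in P would be adjacent to Q inside the independent set S ∪ Q, and symmetrically;
this needs both sides nonempty. -/
theorem FarFrom.of_isIndepSet_union {P Q S : Set V} (hB : IsInducedCompleteBipartite G P Q)
    (hP : P.Nonempty) (hQ : Q.Nonempty) (h₁ : G.IsIndepSet (S ∪ P)) (h₂ : G.IsIndepSet (S ∪ Q))
    {s : V} (hs : s ∈ S) : FarFrom G P Q s := by
  obtain ⟨x, hx⟩ := hP
  obtain ⟨y, hy⟩ := hQ
  refine ⟨fun h => ?_, fun h => ?_, fun z hz h => ?_, fun z hz h => ?_⟩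
  · exact h₂ (.inl hs) (.inr hy) (hB.adj s h y hy).ne (hB.adj s h y hy)
  · exact h₁ (.inl hs) (.inr hx) (hB.adj x hx s h).ne.symm (hB.adj x hx s h).symm
  · exact h₁ (.inl hs) (.inr hz) h.ne h
  · exact h₂ (.inl hs) (.inr hz) h.ne h

/-- The predicate p is far-ness in the main case and trivial when a side is empty. -/
theorem exists_maximal_indep_superset [Finite V] {S : Set V} (p : V → Prop)
    (hS : G.IsIndepSet S) (hp : ∀ v ∈ S, p v) :
    ∃ T, S ⊆ T ∧ Maximal (fun T : Set V => G.IsIndepSet T ∧ ∀ v ∈ T, p v) T :=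
  Finite.exists_le_maximal (p := fun T : Set V => G.IsIndepSet T ∧ ∀ v ∈ T, p v) ⟨hS, hp⟩

theorem SimpleGraph.IsIndepSet.insert {S : Set V} (hS : G.IsIndepSet S) {z : V}
    (hz : ∀ s ∈ S, ¬ G.Adj z s) : G.IsIndepSet (insert z S) := by
  intro x hx y hy hxy hadj
  rcases hx with rfl | hx <;> rcases hy with rfl | hy
  · exact hxy rfl
  · exact hz y hy hadj
  · exact hz x hx hadj.symm
  · exact hS hx hy hxy hadj

theorem maximal_isIndepSet_of_dominating {T : Set V} (hT : G.IsIndepSet T)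
    (h : ∀ z, z ∉ T → ∃ s ∈ T, G.Adj z s) : Maximal (fun T : Set V => G.IsIndepSet T) T := by
  refine ⟨hT, fun U hU hTU z hz => ?_⟩
  by_contra hzT
  obtain ⟨s, hs, hzs⟩ := h z hzT
  exact hU hz (hTU hs) hzs.ne hzs

theorem exists_adj_of_maximal {T : Set V} (hT : Maximal (fun T : Set V => G.IsIndepSet T) T)
    {z : V} (hz : z ∉ T) : ∃ s ∈ T, G.Adj z s := by
  by_contra h
  push Not at h
  exact hz (hT.2 (hT.1.insert h) (Set.subset_insert z T) (Set.mem_insert z T))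

/-- An undominated z outside T ∪ P is not in Q, since P is nonempty. If z has a neighbour in Q it is
attached to Q only, hence dominated by T; if not, z is far and T could be enlarged. -/
theorem maximal_union_of_maximal_far {P Q T : Set V} (hB : IsInducedCompleteBipartite G P Q)
    (hP : P.Nonempty)
    (hT : Maximal (fun T : Set V => G.IsIndepSet T ∧ ∀ v ∈ T, FarFrom G P Q v) T)
    (hdom : ∀ d, AttachedTo G Q P d → ∃ s ∈ T, G.Adj s d) :
    Maximal (fun T : Set V => G.IsIndepSet T) (T ∪ P) := by
  refine maximal_isIndepSet_of_dominating ?_ fun z hz => ?_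
  · rintro x (hx | hx) y (hy | hy) hxy hadj
    · exact hT.1.1 hx hy hxy hadj
    · exact (hT.1.2 x hx).3 y hy hadj
    · exact (hT.1.2 y hy).3 x hx hadj.symm
    · exact hB.indepX hx hy hxy hadj
  · rw [Set.mem_union, not_or] at hz
    by_contra hno
    push Not at hno
    have hzP : ∀ x ∈ P, ¬ G.Adj z x := fun x hx => hno x (.inr hx)
    have hzQ : z ∉ Q := by
      intro h
      obtain ⟨x, hx⟩ := hP
      exact hzP x hx (hB.adj x hx z h).symm
    by_cases hzQ' : ∃ y ∈ Q, G.Adj z y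
    · obtain ⟨s, hs, hsz⟩ := hdom z ⟨hzQ, hz.2, hzQ', hzP⟩
      exact hno s (.inl hs) hsz.symm
    · push Not at hzQ'
      refine hz.1 (hT.2 ⟨hT.1.1.insert fun s hs => hno s (.inl hs), ?_⟩ (Set.subset_insert z T)
        (Set.mem_insert z T))
      rintro v (rfl | hv)
      exacts [⟨hz.2, hzQ, hzP, hzQ'⟩, hT.1.2 v hv]

/-- A maximal independent set containing the other side absorbs both sides. -/
theorem isGenerating_of_eq_empty [Finite V] {P Q : Set V} (hB : IsInducedCompleteBipartite G P Q)
    (h : P = ∅ ∨ Q = ∅) : IsGenerating G P Q := by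
  rcases h with rfl | rfl
  · obtain ⟨T, hQT, hT⟩ := exists_maximal_indep_superset (fun _ => True) hB.indepY (by simp)
    simp only [imp_true_iff, and_true] at hT
    exact ⟨T, hT.1, by simpa using hT, by rwa [Set.union_eq_self_of_subset_right hQT]⟩
  · obtain ⟨T, hPT, hT⟩ := exists_maximal_indep_superset (fun _ => True) hB.indepX (by simp)
    simp only [imp_true_iff, and_true] at hT
    exact ⟨T, hT.1, by rwa [Set.union_eq_self_of_subset_right hPT], by simpa using hT⟩

variable [Fintype V]

open Classical in
/-- The vertices outside `X ∪ Y` with neighbours in exactly one of `X` and `Y`. -/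
noncomputable def oneSided (G : SimpleGraph V) (X Y : Finset V) : Finset V :=
  Finset.univ.filter fun d => AttachedTo G X Y d ∨ AttachedTo G Y X d

open Classical in
/-- The vertices outside the closed neighbourhood of `X ∪ Y` with neighbours in `oneSided G X Y`. -/
noncomputable def outerVertices (G : SimpleGraph V) (X Y : Finset V) : Finset V :=
  Finset.univ.filter fun v => FarFrom G X Y v ∧ ∃ d ∈ oneSided G X Y, G.Adj v d

theorem mem_oneSided {X Y : Finset V} {d : V} :
    d ∈ oneSided G X Y ↔ AttachedTo G X Y d ∨ AttachedTo G Y X d := by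
  simp [oneSided]

theorem mem_outerVertices {X Y : Finset V} {v : V} :
    v ∈ outerVertices G X Y ↔ FarFrom G X Y v ∧ ∃ d ∈ oneSided G X Y, G.Adj v d := by
  simp [outerVertices]

/-- A vertex attached to one side is not dominated by the other side, so S must dominate it.
Conversely, a dominating set extends to a maximal independent set of far vertices. -/
theorem isGenerating_iff {X Y : Finset V}
    (hB : IsInducedCompleteBipartite G (X : Set V) (Y : Set V))
    (hX : X.Nonempty) (hY : Y.Nonempty) :
    IsGenerating G (X : Set V) (Y : Set V) ↔
      HasIndepDominating G (outerVertices G X Y) (oneSided G X Y) := by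
  classical
  have hX' : (X : Set V).Nonempty := hX
  have hY' : (Y : Set V).Nonempty := hY
  constructor
  · rintro ⟨S, hS, h₁, h₂⟩
    have hfar : ∀ s ∈ S, FarFrom G (X : Set V) (Y : Set V) s := fun s hs =>
      .of_isIndepSet_union hB hX' hY' h₁.1 h₂.1 hs
    refine ⟨(outerVertices G X Y).filter (· ∈ S), Finset.filter_subset _ _,
      hS.mono fun v hv => (Finset.mem_filter.1 hv).2, fun d hd => ?_⟩
    have : ∃ s ∈ S, G.Adj s d := by
      rcases mem_oneSided.1 hd with hd | hd
      · have hdS : d ∉ S := fun h => (hfar d h).ne_attachedTo hd rfl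
        obtain ⟨s, hs | hs, hds⟩ := exists_adj_of_maximal h₂ (z := d) (by
          rintro (h | h)
          exacts [hdS h, hd.2 h])
        exacts [⟨s, hs, hds.symm⟩, (hd.4 s hs hds).elim]
      · have hdS : d ∉ S := fun h => (hfar d h).swap.ne_attachedTo hd rfl
        obtain ⟨s, hs | hs, hds⟩ := exists_adj_of_maximal h₁ (z := d) (by
          rintro (h | h)
          exacts [hdS h, hd.2 h])
        exacts [⟨s, hs, hds.symm⟩, (hd.4 s hs hds).elim]
    obtain ⟨s, hs, hsd⟩ := this
    exact ⟨s, Finset.mem_filter.2 ⟨mem_outerVertices.2 ⟨hfar s hs, d, hd, hsd⟩, hs⟩, hsd⟩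
  · rintro ⟨S, hSA, hS, hdom⟩
    -- Maximality is taken among all far vertices, not only those in A, so that far vertices without
    -- neighbours in D are also dominated.
    obtain ⟨T, hST, hT⟩ := exists_maximal_indep_superset (FarFrom G (X : Set V) (Y : Set V)) hS
      fun v hv => (mem_outerVertices.1 (hSA hv)).1
    have hdomT : ∀ d ∈ oneSided G X Y, ∃ s ∈ T, G.Adj s d := fun d hd =>
      (hdom d hd).imp fun s hs => ⟨hST hs.1, hs.2⟩
    refine ⟨T, hT.1.1, ?_, ?_⟩
    · exact maximal_union_of_maximal_far hB hX' hT fun d hd => hdomT d (mem_oneSided.2 (.inr hd))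
    · refine maximal_union_of_maximal_far hB.swap hY' ?_
        fun d hd => hdomT d (mem_oneSided.2 (.inl hd))
      have : ∀ v, FarFrom G (Y : Set V) (X : Set V) v ↔ FarFrom G (X : Set V) (Y : Set V) v :=
        fun v => ⟨FarFrom.swap, FarFrom.swap⟩
      simpa only [this] using hT

end Generating

/-! ### Consequences of the absence of 6- and 7-cycles -/

section ShortCycles

variable {V : Type*} [Fintype V] {G : SimpleGraph V} {X Y : Finset V}

theorem anchors_eq_of_outer_edge (h6 : (SimpleGraph.cycleGraph 6).Free G)
    (h7 : (SimpleGraph.cycleGraph 7).Free G)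
    (hB : IsInducedCompleteBipartite G (X : Set V) (Y : Set V)) (hX : X.Nonempty)
    (hY : Y.Nonempty)
    {v w a b : V} (hv : v ∈ outerVertices G X Y)
    (hw : w ∈ outerVertices G X Y) (ha : a ∈ oneSided G X Y) (hb : b ∈ oneSided G X Y)
    (hvw : G.Adj v w) (hva : G.Adj v a) (hwb : G.Adj w b) :
    anchors G (X : Set V) Y a = anchors G (X : Set V) Y b :=
  anchors_eq_of_adj h6 h7 hB hX hY (mem_outerVertices.1 hv).1 (mem_outerVertices.1 hw).1 hvw
    (mem_oneSided.1 ha) (mem_oneSided.1 hb) hva hwb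

theorem anchors_eq_of_outer_vertex (h6 : (SimpleGraph.cycleGraph 6).Free G)
    (hB : IsInducedCompleteBipartite G (X : Set V) (Y : Set V)) (hX : X.Nonempty)
    (hY : Y.Nonempty)
    {v a b : V} (hv : v ∈ outerVertices G X Y)
    (hv' : ∃ w ∈ outerVertices G X Y, G.Adj v w) (ha : a ∈ oneSided G X Y)
    (hb : b ∈ oneSided G X Y) (hva : G.Adj v a) (hvb : G.Adj v b) :
    anchors G (X : Set V) Y a = anchors G (X : Set V) Y b := by
  obtain ⟨w, hw, hvw⟩ := hv'
  obtain ⟨hwf, e, he, hwe⟩ := mem_outerVertices.1 hw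
  exact anchors_eq_of_common_adj h6 hB hX hY (mem_outerVertices.1 hv).1 hwf hvw
    (mem_oneSided.1 ha) (mem_oneSided.1 hb) (mem_oneSided.1 he) hva hvb hwe

theorem outer_ne_oneSided {v d : V} (hv : v ∈ outerVertices G X Y) (hd : d ∈ oneSided G X Y) :
    v ≠ d := by
  have hv := (mem_outerVertices.1 hv).1
  rcases mem_oneSided.1 hd with hd | hd
  exacts [hv.ne_attachedTo hd, hv.swap.ne_attachedTo hd]

/-- Anchors propagate along the edges of the path, so the two ends see vertices with a common anchor
x. If these differ, x closes a path of three vertices to a hexagon and one of four to a heptagon. -/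
theorem twinStructure_outerVertices (h6 : (SimpleGraph.cycleGraph 6).Free G)
    (h7 : (SimpleGraph.cycleGraph 7).Free G)
    (hB : IsInducedCompleteBipartite G (X : Set V) (Y : Set V)) (hX : X.Nonempty)
    (hY : Y.Nonempty) :
    TwinStructure G (outerVertices G X Y) (oneSided G X Y) where
  exists_adj v hv := (mem_outerVertices.1 hv).2
  eq_of_path_three w hw v hv u hu hwu hwv hvu a ha c hc hwa huc := by
    by_contra hac
    -- The neighbour e of the middle vertex carries the anchors from a to c.
    obtain ⟨e, he, hve⟩ := (mem_outerVertices.1 hv).2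
    obtain ⟨x, hx, hax, hcx⟩ := exists_common_anchor (mem_oneSided.1 ha)
      ((anchors_eq_of_outer_edge h6 h7 hB hX hY hw hv ha he hwv hwa hve).trans
        (anchors_eq_of_outer_edge h6 h7 hB hX hY hv hu he hc hvu hve huc))
    refine h6.not_hexagon (p := x) (q := a) (r := w) (s := v) (t := u) (u := c) ?_ hax.symm
      hwa.symm hwv hvu huc hcx
    have h1 := outer_ne_oneSided hw ha
    have h2 := outer_ne_oneSided hw hc
    have h3 := outer_ne_oneSided hv ha
    have h4 := outer_ne_oneSided hv hc
    have h5 := outer_ne_oneSided hu ha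
    have h6 := outer_ne_oneSided hu hc
    have h7 := (mem_outerVertices.1 hw).1.ne hx
    have h8 := (mem_outerVertices.1 hv).1.ne hx
    have h9 := (mem_outerVertices.1 hu).1.ne hx
    have := hax.ne; have := hcx.ne; have := hwv.ne; have := hvu.ne
    simp only [List.nodup_cons, List.mem_cons, List.not_mem_nil, not_or, or_false]
    and_intros <;> grind
  eq_of_path_four t ht u hu v hv w hw htv htw huw htu huv hvw a ha c hc hta hwc := by
    by_contra hac
    obtain ⟨e, he, hue⟩ := (mem_outerVertices.1 hu).2
    obtain ⟨f, hf, hvf⟩ := (mem_outerVertices.1 hv).2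
    obtain ⟨x, hx, hax, hcx⟩ := exists_common_anchor (mem_oneSided.1 ha)
      ((anchors_eq_of_outer_edge h6 h7 hB hX hY ht hu ha he htu hta hue).trans
        ((anchors_eq_of_outer_edge h6 h7 hB hX hY hu hv he hf huv hue hvf).trans
        (anchors_eq_of_outer_edge h6 h7 hB hX hY hv hw hf hc hvw hvf hwc)))
    refine h7.not_heptagon (p := x) (q := a) (r := t) (s := u) (t := v) (u := w) (w := c) ?_
      hax.symm hta.symm htu huv hvw hwc hcx
    have h1 := outer_ne_oneSided hw ha
    have h2 := outer_ne_oneSided hw hc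
    have h3 := outer_ne_oneSided hv ha
    have h4 := outer_ne_oneSided hv hc
    have h5 := outer_ne_oneSided hu ha
    have h6 := outer_ne_oneSided hu hc
    have := outer_ne_oneSided ht ha
    have := outer_ne_oneSided ht hc
    have h7 := (mem_outerVertices.1 hw).1.ne hx
    have h8 := (mem_outerVertices.1 hv).1.ne hx
    have h9 := (mem_outerVertices.1 hu).1.ne hx
    have := (mem_outerVertices.1 ht).1.ne hx
    have := hax.ne; have := hcx.ne; have := htu.ne; have := huv.ne; have := hvw.ne
    simp only [List.nodup_cons, List.mem_cons, List.not_mem_nil, not_or, or_false]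
    and_intros <;> grind

/-- All three vertices of D on the path have the same anchors, and a common anchor closes the path
to a hexagon or a heptagon. Non-isolation is what rules out attachment to opposite sides at a single
vertex. -/
theorem crossFree_outerVertices (h6 : (SimpleGraph.cycleGraph 6).Free G)
    (h7 : (SimpleGraph.cycleGraph 7).Free G)
    (hB : IsInducedCompleteBipartite G (X : Set V) (Y : Set V)) (hX : X.Nonempty)
    (hY : Y.Nonempty) : CrossFree G (outerVertices G X Y) (oneSided G X Y) where
  no_path_five v hv w hw hv' hw' hne a ha b hb c hc hab hbc hac hva hvb hwb hwc := by
    obtain ⟨x, hx, hax, hcx⟩ := exists_common_anchor (mem_oneSided.1 ha)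
      ((anchors_eq_of_outer_vertex h6 hB hX hY hv hv' ha hb hva hvb).trans
        (anchors_eq_of_outer_vertex h6 hB hX hY hw hw' hb hc hwb hwc))
    have hbx : b ≠ x := by
      rintro rfl
      rcases mem_oneSided.1 hb with hb | hb <;> rcases hx with hx | hx
      exacts [hb.1 hx, hb.2 hx, hb.2 hx, hb.1 hx]
    refine h6.not_hexagon (p := x) (q := a) (r := v) (s := b) (t := w) (u := c) ?_ hax.symm
      hva.symm hvb hwb.symm hwc hcx
    have h1 := outer_ne_oneSided hw ha
    have h2 := outer_ne_oneSided hw hc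
    have h3 := outer_ne_oneSided hv ha
    have h4 := outer_ne_oneSided hv hc
    have h7 := (mem_outerVertices.1 hw).1.ne hx
    have h8 := (mem_outerVertices.1 hv).1.ne hx
    have := hax.ne; have := hcx.ne; have := hvb.ne; have := hwb.ne
    simp only [List.nodup_cons, List.mem_cons, List.not_mem_nil, not_or, or_false]
    and_intros <;> grind
  no_path_six v hv w hw u hu hv' hvw hvu hwu a ha b hb c hc hab hbc hac hva hvb hwb huc := by
    obtain ⟨x, hx, hax, hcx⟩ := exists_common_anchor (mem_oneSided.1 ha)
      ((anchors_eq_of_outer_vertex h6 hB hX hY hv hv' ha hb hva hvb).trans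
        (anchors_eq_of_outer_edge h6 h7 hB hX hY hw hu hb hc hwu hwb huc))
    have hbx : b ≠ x := by
      rintro rfl
      rcases mem_oneSided.1 hb with hb | hb <;> rcases hx with hx | hx
      exacts [hb.1 hx, hb.2 hx, hb.2 hx, hb.1 hx]
    refine h7.not_heptagon (p := x) (q := a) (r := v) (s := b) (t := w) (u := u) (w := c) ?_
      hax.symm hva.symm hvb hwb.symm hwu huc hcx
    have h1 := outer_ne_oneSided hw ha
    have h2 := outer_ne_oneSided hw hc
    have h3 := outer_ne_oneSided hv ha
    have h4 := outer_ne_oneSided hv hc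
    have h5 := outer_ne_oneSided hu ha
    have h6 := outer_ne_oneSided hu hc
    have := outer_ne_oneSided hu hb
    have h7 := (mem_outerVertices.1 hw).1.ne hx
    have h8 := (mem_outerVertices.1 hv).1.ne hx
    have h9 := (mem_outerVertices.1 hu).1.ne hx
    have := hax.ne; have := hcx.ne; have := hvb.ne; have := hwb.ne; have := hwu.ne
    simp only [List.nodup_cons, List.mem_cons, List.not_mem_nil, not_or, or_false]
    and_intros <;> grind

end ShortCycles

/-! ### Reasoning about programs -/

namespace Ram

/-- The registers written by a program. -/
def Prog.vars : Prog → List ℕ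
  | .skip => []
  | .set x _ => [x]
  | .put _ _ _ => []
  | .seq p q => p.vars ++ q.vars
  | .ite _ p q => p.vars ++ q.vars
  | .loop _ p => p.vars

/-- The arrays written by a program. -/
def Prog.arrs : Prog → List ℕ
  | .skip => []
  | .set _ _ => []
  | .put a _ _ => [a]
  | .seq p q => p.arrs ++ q.arrs
  | .ite _ p q => p.arrs ++ q.arrs
  | .loop _ p => p.arrs

/-- `s'` agrees with `s` on everything that `p` does not write. -/
structure Agree (p : Prog) (s s' : State) : Prop where
  var : ∀ x, x ∉ p.vars → s'.var x = s.var x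
  arr : ∀ a, a ∉ p.arrs → s'.arr a = s.arr a

theorem Agree.refl (p : Prog) (s : State) : Agree p s s := ⟨fun _ _ => rfl, fun _ _ => rfl⟩

theorem Agree.mono {p q : Prog} {s s' : State} (h : Agree p s s')
    (hv : p.vars ⊆ q.vars) (ha : p.arrs ⊆ q.arrs) : Agree q s s' :=
  ⟨fun x hx => h.var x fun h => hx (hv h), fun a hx => h.arr a fun h => hx (ha h)⟩

theorem Agree.trans {p : Prog} {s s' s'' : State} (h : Agree p s s') (h' : Agree p s' s'') :
    Agree p s s'' :=
  ⟨fun x hx => (h'.var x hx).trans (h.var x hx), fun a ha => (h'.arr a ha).trans (h.arr a ha)⟩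

@[simp] theorem State.setArr_var (s : State) (a i k : ℕ) : (s.setArr a i k).var = s.var := rfl

theorem State.setArr_arr (s : State) (a i k b j : ℕ) :
    (s.setArr a i k).arr b j = if b = a ∧ j = i then k else s.arr b j := by
  by_cases h : b = a
  · subst h; simp [State.setArr, Function.update_apply]
  · simp [State.setArr, h]

theorem State.setArr_arr_of_ne (s : State) {a b : ℕ} (i k : ℕ) (h : b ≠ a) :
    (s.setArr a i k).arr b = s.arr b := by
  simp [State.setArr, h]

@[simp] theorem State.setVar_var_self (s : State) (x k : ℕ) : (s.setVar x k).var x = k := by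
  simp [State.setVar]

theorem State.setVar_var_of_ne (s : State) {x y : ℕ} (k : ℕ) (h : y ≠ x) :
    (s.setVar x k).var y = s.var y := by
  simp [State.setVar, h]

/-- The frame rule: the sets of written names are read off the program text, so later side
conditions are settled by `decide`. -/
theorem Run.agree {W : ℕ} {p : Prog} {s s' : State} {t : ℕ} (h : Run W p s t s') :
    Agree p s s' := by
  induction h with
  | skip => exact .refl _ _
  | set s x e he =>
    exact ⟨fun y hy => s.setVar_var_of_ne _ (by simpa [Prog.vars] using hy), fun _ _ => rfl⟩
  | put s a i e hi he =>
    exact ⟨fun _ _ => rfl, fun b hb => s.setArr_arr_of_ne _ _ (by simpa [Prog.arrs] using hb)⟩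
  | seq hp hq ihp ihq =>
    exact (ihp.mono (by simp [Prog.vars]) (by simp [Prog.arrs])).trans
      (ihq.mono (by simp [Prog.vars]) (by simp [Prog.arrs]))
  | iteTrue he h hp ih => exact ih.mono (by simp [Prog.vars]) (by simp [Prog.arrs])
  | iteFalse he h hp ih => exact ih.mono (by simp [Prog.vars]) (by simp [Prog.arrs])
  | loopTrue he h hp hl ihp ihl =>
    exact (ihp.mono (by simp [Prog.vars]) (by simp [Prog.arrs])).trans ihl
  | loopFalse => exact .refl _ _

/-- Started in `s`, the program halts within `T` steps in a state that satisfies `Q`. -/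
def Ex (W : ℕ) (p : Prog) (s : State) (T : ℕ) (Q : State → Prop) : Prop :=
  ∃ t s', Run W p s t s' ∧ t ≤ T ∧ Q s'

/-- The term `e` is evaluated to `k` without overflow. -/
def IsNum (W : ℕ) (s : State) (e : Term) (k : ℕ) : Prop :=
  e.Fits W s ∧ e.val s = k

/-! ### Timed rules for total correctness -/

section Rules

variable {W : ℕ} {p q : Prog} {s : State} {T T' : ℕ} {Q Q' : State → Prop} {e f : Term}

theorem Ex.mono (h : Ex W p s T Q) (hT : T ≤ T') (hQ : ∀ s', Agree p s s' → Q s' → Q' s') :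
    Ex W p s T' Q' := by
  obtain ⟨t, s', hr, ht, hs⟩ := h
  exact ⟨t, s', hr, ht.trans hT, hQ s' hr.agree hs⟩

theorem Ex.skip (h : Q s) : Ex W .skip s 1 Q := ⟨1, s, .skip s, le_rfl, h⟩

theorem Ex.set {x k : ℕ} (he : IsNum W s e k) (h : Q (s.setVar x k)) :
    Ex W (.set x e) s (e.cost + 1) Q :=
  ⟨_, _, .set s x e he.1, le_rfl, he.2 ▸ h⟩

theorem Ex.put {a i k : ℕ} (he : IsNum W s e i) (hf : IsNum W s f k) (h : Q (s.setArr a i k)) :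
    Ex W (.put a e f) s (e.cost + f.cost + 1) Q :=
  ⟨_, _, .put s a e f he.1 hf.1, le_rfl, he.2 ▸ hf.2 ▸ h⟩

theorem Ex.seq (hp : Ex W p s T Q') (hq : ∀ s', Agree p s s' → Q' s' → Ex W q s' T' Q) :
    Ex W (.seq p q) s (T + T') Q := by
  obtain ⟨t, s', hr, ht, hs⟩ := hp
  obtain ⟨t', s'', hr', ht', hs'⟩ := hq s' hr.agree hs
  exact ⟨_, _, .seq hr hr', by omega, hs'⟩

/-- The bounds of the two branches are added instead of taking their maximum, which keeps the time
bounds linear expressions. -/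
theorem Ex.ite {k : ℕ} (he : IsNum W s e k) (hp : k ≠ 0 → Ex W p s T Q)
    (hq : k = 0 → Ex W q s T' Q) : Ex W (.ite e p q) s (e.cost + 1 + (T + T')) Q := by
  obtain ⟨he, rfl⟩ := he
  by_cases h : e.val s = 0
  · obtain ⟨t, s', hr, ht, hs⟩ := hq h
    exact ⟨_, _, .iteFalse he h hr, by omega, hs⟩
  · obtain ⟨t, s', hr, ht, hs⟩ := hp h
    exact ⟨_, _, .iteTrue he h hr, by omega, hs⟩

/-- The truth value of `P` as a number. -/
noncomputable def ind (P : Prop) : ℕ :=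
  open Classical in if P then 1 else 0

theorem ind_of {P : Prop} (h : P) : ind P = 1 := if_pos h

theorem ind_of_not {P : Prop} (h : ¬ P) : ind P = 0 := if_neg h

theorem ind_eq_zero {P : Prop} : ind P = 0 ↔ ¬ P := by simp [ind]

theorem ind_ne_zero {P : Prop} : ind P ≠ 0 ↔ P := by simp [ind]

theorem ind_le_one (P : Prop) : ind P ≤ 1 := by unfold ind; split <;> simp

theorem ind_congr {P P' : Prop} (h : P ↔ P') : ind P = ind P' := by rw [propext h]

theorem IsNum.lit {k : ℕ} (h : k < W) : IsNum W s (.lit k) k := ⟨h, rfl⟩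

theorem IsNum.var {x k : ℕ} (h : s.var x = k) (hk : k < W) : IsNum W s (.var x) k :=
  ⟨by rw [← h] at hk; exact hk, h⟩

theorem IsNum.get {a i k : ℕ} (he : IsNum W s e i) (h : s.arr a i = k) (hk : k < W) :
    IsNum W s (.get a e) k := by
  obtain ⟨he, rfl⟩ := he
  exact ⟨⟨he, by rwa [h]⟩, h⟩

theorem IsNum.bin {i j : ℕ} (o : Op) (he : IsNum W s e i) (hf : IsNum W s f j)
    (h : o.val i j < W) : IsNum W s (.bin o e f) (o.val i j) := by
  obtain ⟨he, rfl⟩ := he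
  obtain ⟨hf, rfl⟩ := hf
  exact ⟨⟨he, hf, h⟩, rfl⟩

theorem IsNum.lt {i j : ℕ} (he : IsNum W s e i) (hf : IsNum W s f j) (hW : 1 < W) :
    IsNum W s (.bin .lt e f) (ind (i < j)) := by
  have : Op.lt.val i j = ind (i < j) := by simp [Op.val, ind]
  rw [← this]
  exact .bin _ he hf (this ▸ (ind_le_one _).trans_lt hW)

theorem IsNum.eq {i j : ℕ} (he : IsNum W s e i) (hf : IsNum W s f j) (hW : 1 < W) :
    IsNum W s (.bin .eq e f) (ind (i = j)) := by
  have : Op.eq.val i j = ind (i = j) := by simp [Op.val, ind]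
  rw [← this]
  exact .bin _ he hf (this ▸ (ind_le_one _).trans_lt hW)

theorem IsNum.and {P P' : Prop} (he : IsNum W s e (ind P)) (hf : IsNum W s f (ind P'))
    (hW : 1 < W) : IsNum W s (.bin .mul e f) (ind (P ∧ P')) := by
  have : Op.mul.val (ind P) (ind P') = ind (P ∧ P') := by
    by_cases h : P <;> by_cases h' : P' <;> simp [Op.val, ind, h, h']
  rw [← this]
  exact .bin _ he hf (this ▸ (ind_le_one _).trans_lt hW)

theorem IsNum.not {P : Prop} (he : IsNum W s e (ind P)) (hW : 1 < W) :
    IsNum W s (.bin .eq e (.lit 0)) (ind (¬ P)) := by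
  rw [← ind_congr ind_eq_zero]
  exact he.eq (.lit (by omega)) hW

theorem IsNum.iff {P P' : Prop} (he : IsNum W s e (ind P)) (hf : IsNum W s f (ind P'))
    (hW : 1 < W) : IsNum W s (.bin .eq e f) (ind (P ↔ P')) := by
  rw [show ind (P ↔ P') = ind (ind P = ind P') from ind_congr (by
    by_cases h : P <;> by_cases h' : P' <;> simp [ind, h, h'])]
  exact he.eq hf hW

theorem IsNum.congr {P P' : Prop} (he : IsNum W s e (ind P)) (h : P ↔ P') :
    IsNum W s e (ind P') := ind_congr h ▸ he

end Rules

/-- Register `i` runs from `lo` up to, and excluding, `hi`. -/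
def forRange (i : ℕ) (lo hi : Term) (p : Prog) : Prog :=
  .seq (.set i lo) (.loop (.bin .lt (.var i) hi) (.seq p (.set i (.bin .add (.var i) (.lit 1)))))

/-- Induction on the number m of remaining iterations. The 7 steps besides `hi` and the body are 3
for the test and branch and 4 for the increment; the extra 1 in m + 1 pays for the failing last
test. The frame program q refers every state to the start of the loop. -/
theorem Ex.forRange_aux {W : ℕ} {p : Prog} {i b T : ℕ} {hi : Term} {s₀ : State}
    (Inv : ℕ → State → Prop) {q : Prog} (hqv : i ∈ q.vars) (hpv : p.vars ⊆ q.vars)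
    (hpa : p.arrs ⊆ q.arrs) (hb : b < W)
    (hhi : ∀ s, Agree q s₀ s → IsNum W s hi b) (hip : i ∉ p.vars)
    (hinv : ∀ k s x, Inv k s → Inv k (s.setVar i x)) (m : ℕ) :
    ∀ k s, k + m = b → Agree q s₀ s → s.var i = k → Inv k s →
      (∀ k' s', k ≤ k' → k' < b → Agree q s₀ s' → s'.var i = k' → Inv k' s' →
        Ex W p s' T (Inv (k' + 1))) →
      Ex W (.loop (.bin .lt (.var i) hi) (.seq p (.set i (.bin .add (.var i) (.lit 1))))) s
        ((m + 1) * (T + hi.cost + 7)) fun s' => Inv b s' := by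
  have hset : ∀ s k, Agree q s (s.setVar i k) := fun s k =>
    ⟨fun y hy => s.setVar_var_of_ne k (by rintro rfl; exact hy hqv), fun _ _ => rfl⟩
  induction m with
  | zero =>
    intro k s hkm hs hik hk _
    obtain rfl : k = b := hkm
    refine ⟨_, _, .loopFalse (e := .bin .lt (.var i) hi) (s := s) ?_ ?_, ?_, hk⟩
    · have h1 := hhi s hs
      exact ⟨by simpa [Term.Fits, hik], h1.1, by
        simp [Op.val, Term.val, h1.2, hik]; omega⟩
    · simp [Term.val, Op.val, (hhi s hs).2, hik]
    · simp only [Term.cost]; omega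
  | succ m ih =>
    intro k s hkm hs hik hk hbody
    have h1 := hhi s hs
    obtain ⟨t, s', hr, ht, hs'⟩ := hbody k s le_rfl (by omega) hs hik hk
    have hag : Agree q s₀ s' := hs.trans (hr.agree.mono hpv hpa)
    have hi' : s'.var i = k := (hr.agree.var i hip).trans hik
    obtain ⟨t', s'', hr', ht', hs''⟩ := ih (k + 1) (s'.setVar i (k + 1)) (by omega)
      (hag.trans (hset _ _)) (by simp) (hinv _ _ _ hs')
      fun k' s' hkk' => hbody k' s' (by omega)
    have hstep : Run W (.set i (.bin .add (.var i) (.lit 1))) s' 4 (s'.setVar i (k + 1)) := by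
      have := Run.set (W := W) s' i (.bin .add (.var i) (.lit 1))
        ⟨by simp [Term.Fits, hi']; omega, by simp [Term.Fits]; omega, by
          simp [Op.val, Term.val, hi']; omega⟩
      simpa [Term.val, Op.val, hi', Term.cost] using this
    refine ⟨_, _, .loopTrue ⟨?_, h1.1, ?_⟩ ?_ (.seq hr hstep) hr', ?_, hs''⟩
    · simp [Term.Fits, hik]; omega
    · simp [Op.val, Term.val, h1.2, hik]; split <;> omega
    · simp [Op.val, Term.val, h1.2, hik]; omega
    · simp only [Term.cost]
      rw [Nat.succ_mul (m + 1)]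
      omega

theorem Ex.forRange {W : ℕ} {p : Prog} {i a b T : ℕ} {lo hi : Term} {s : State}
    (Inv : ℕ → State → Prop) (hlo : IsNum W s lo a) (hab : a ≤ b) (hb : b < W)
    (hhi : ∀ s', Agree (forRange i lo hi p) s s' → IsNum W s' hi b) (hip : i ∉ p.vars)
    (hinv : ∀ k s x, Inv k s → Inv k (s.setVar i x)) (h0 : Inv a s)
    (hbody : ∀ k s', a ≤ k → k < b → Agree (Ram.forRange i lo hi p) s s' → s'.var i = k →
      Inv k s' → Ex W p s' T (Inv (k + 1))) :
    Ex W (Ram.forRange i lo hi p) s (lo.cost + 1 + (b - a + 1) * (T + hi.cost + 7))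
      (Inv b) := by
  have hmem : i ∈ (Ram.forRange i lo hi p).vars := by simp [Ram.forRange, Prog.vars]
  refine Ex.seq (Q' := fun s' => s' = s.setVar i a) (.set hlo rfl) ?_
  rintro _ - rfl
  refine Ex.forRange_aux Inv (q := Ram.forRange i lo hi p) hmem ?_ ?_ hb hhi hip hinv (b - a) a _
    (by omega) ?_ (by simp) (hinv _ _ _ h0) hbody
  · intro x hx; simp [Ram.forRange, Prog.vars, hx]
  · intro x hx; simp [Ram.forRange, Prog.arrs, hx]
  · exact ⟨fun y hy => s.setVar_var_of_ne _ (by rintro rfl; exact hy hmem), fun _ _ => rfl⟩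

/-- Register `i` runs through the vertices; their number is in register `0`. -/
def forAll (i : ℕ) (p : Prog) : Prog :=
  forRange i (.lit 0) (.var 0) p

theorem Ex.forAll {W n : ℕ} {p : Prog} {i T : ℕ} {s : State} (Inv : ℕ → State → Prop)
    (hn : s.var 0 = n) (hnW : n < W) (hi : 0 ∉ (forAll i p).vars) (hip : i ∉ p.vars)
    (hinv : ∀ k s x, Inv k s → Inv k (s.setVar i x)) (h0 : Inv 0 s)
    (hbody : ∀ (k : Fin n) s', Agree (Ram.forAll i p) s s' → s'.var i = k →
      Inv k s' → Ex W p s' T (Inv (k + 1))) :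
    Ex W (Ram.forAll i p) s ((n + 1) * (T + 10)) (Inv n) := by
  refine (Ex.forRange (T := T) Inv (.lit (by omega)) (Nat.zero_le n) hnW ?_ hip hinv h0
    fun k s' _ hk => hbody ⟨k, hk⟩ s').mono ?_ fun _ _ h => h
  · exact fun s' hs' => .var ((hs'.var 0 hi).trans hn) hnW
  · simp only [Term.cost, Nat.sub_zero]
    have : (n + 1) * (T + 10) = (n + 1) * (T + 1 + 7) + (n + 1) * 2 := by ring
    omega

/-- The number of values of `i` for which `e` is nonzero is computed in register `r`. -/
def count (r i : ℕ) (e : Term) : Prog :=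
  .seq (.set r (.lit 0)) (forAll i (.ite e (.set r (.bin .add (.var r) (.lit 1))) .skip))

theorem card_filter_val_lt_succ {n : ℕ} (P : Fin n → Prop) [DecidablePred P] (k : Fin n) :
    (Finset.univ.filter fun v : Fin n => v.val < k.val + 1 ∧ P v).card =
      (Finset.univ.filter fun v : Fin n => v.val < k.val ∧ P v).card + if P k then 1 else 0 := by
  split_ifs with hk
  · rw [← Finset.card_insert_of_notMem (a := k) (by simp)]
    congr 1
    ext v
    simp only [Finset.mem_filter, Finset.mem_univ, true_and, Finset.mem_insert, Nat.lt_succ_iff,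
      le_iff_lt_or_eq, Fin.val_inj]
    grind
  · refine (congrArg Finset.card (Finset.ext fun v => ?_)).trans (Nat.add_zero _).symm
    simp only [Finset.mem_filter, Finset.mem_univ, true_and, Nat.lt_succ_iff,
      le_iff_lt_or_eq, Fin.val_inj]
    grind

theorem Ex.count {W n r i : ℕ} {e : Term} {s : State} (P : Fin n → Prop) [DecidablePred P]
    (hn : s.var 0 = n) (hnW : n + 1 < W) (hri : r ≠ i) (hr : r ≠ 0) (hi : i ≠ 0)
    (he : ∀ (k : Fin n) s', Agree (count r i e) s s' → s'.var i = k → IsNum W s' e (ind (P k))) :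
    Ex W (Ram.count r i e) s ((n + 1) * (e.cost + 20)) fun s' =>
      s'.var r = (Finset.univ.filter P).card := by
  refine (Ex.seq (Q' := fun s' => s' = s.setVar r 0) (.set (.lit (by omega)) rfl) ?_ ).mono
    (T := 2 + (n + 1) * (e.cost + 1 + (4 + 1) + 10)) ?_ fun _ _ h => h
  swap
  · have : (n + 1) * (e.cost + 20) = (n + 1) * (e.cost + 1 + (4 + 1) + 10) + (n + 1) * 4 := by ring
    omega
  rintro _ - rfl
  have hsub : ∀ {s'}, Agree (Ram.forAll i (.ite e (.set r (.bin .add (.var r) (.lit 1))) .skip))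
      (s.setVar r 0) s' → Agree (Ram.count r i e) s s' := by
    intro s' h
    refine Agree.trans (s' := s.setVar r 0) ?_ (h.mono ?_ ?_)
    · exact ⟨fun y hy => s.setVar_var_of_ne _ (by rintro rfl; simp [Ram.count, Prog.vars] at hy),
        fun _ _ => rfl⟩
    · simp [Ram.count, Prog.vars]
    · simp [Ram.count, Prog.arrs]
  refine (Ex.forAll (n := n) (T := e.cost + 1 + (4 + 1)) (fun k s' => s'.var r =
    (Finset.univ.filter fun v : Fin n => v.val < k ∧ P v).card) ?_ (by omega) ?_ ?_ ?_ ?_ ?_).mono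
    le_rfl ?_
  · rw [State.setVar_var_of_ne _ _ hr.symm, hn]
  · simp [Ram.forAll, Ram.forRange, Prog.vars, hr.symm, hi.symm]
  · simp [Prog.vars, hri.symm]
  · intro k s' x h
    simpa only [State.setVar_var_of_ne _ _ hri] using h
  · simp
  · intro k s' hag hik hk
    have hle : (Finset.univ.filter fun v : Fin n => v.val < k ∧ P v).card ≤ n :=
      (Finset.card_le_univ _).trans_eq (Fintype.card_fin n)
    refine Ex.ite (he k s' (hsub hag) hik) (fun h => ?_) fun h => ?_
    · rw [ind_ne_zero] at h
      refine Ex.set (k := s'.var r + 1) ?_ ?_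
      · exact .bin .add (.var rfl (by omega)) (.lit (by omega)) (by simp only [Op.val]; omega)
      · rw [State.setVar_var_self, card_filter_val_lt_succ, if_pos h, hk]
    · rw [ind_eq_zero] at h
      refine Ex.skip ?_
      rw [card_filter_val_lt_succ, if_neg h, hk, Nat.add_zero]
  · intro s' _ h
    simpa using h

/-- A value of `i` for which `e` is nonzero, if there is one, is written to register `r`. -/
def scan (r i : ℕ) (e : Term) : Prog :=
  forAll i (.ite e (.set r (.var i)) .skip)

/-- Register r keeps its old value when the search fails, so a value written beforehand serves as a
default. -/
theorem Ex.scan {W n r i : ℕ} {e : Term} {s : State} (P : Fin n → Prop)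
    (hn : s.var 0 = n) (hnW : n < W) (hri : r ≠ i) (hr : r ≠ 0) (hi : i ≠ 0)
    (he : ∀ (k : Fin n) s', Agree (scan r i e) s s' → s'.var i = k → IsNum W s' e (ind (P k))) :
    Ex W (Ram.scan r i e) s ((n + 1) * (e.cost + 20)) fun s' =>
      (∃ k, P k ∧ s'.var r = k) ∨ (∀ k, ¬ P k) ∧ s'.var r = s.var r := by
  refine (Ex.forAll (n := n) (T := e.cost + 1 + (2 + 1)) (fun k s' =>
    (∃ v, P v ∧ s'.var r = v) ∨ (∀ v : Fin n, v.val < k → ¬ P v) ∧ s'.var r = s.var r)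
    hn (by omega) ?_ ?_ ?_ ?_ ?_).mono ?_ ?_
  · simp [Ram.forAll, Ram.forRange, Prog.vars, hr.symm, hi.symm]
  · simp [Prog.vars, hri.symm]
  · intro k s' x h
    simpa only [State.setVar_var_of_ne _ _ hri] using h
  · simp
  · intro k s' hag hik hk
    refine Ex.ite (he k s' hag hik) (fun h => ?_) fun h => ?_
    · rw [ind_ne_zero] at h
      exact Ex.set (.var hik (by omega)) (.inl ⟨k, h, by simp⟩)
    · rw [ind_eq_zero] at h
      refine Ex.skip (hk.imp_right fun hk => ⟨fun v hv => ?_, hk.2⟩)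
      rcases Nat.lt_succ_iff_lt_or_eq.1 hv with hv | hv
      · exact hk.1 v hv
      · rwa [Fin.ext hv]
  · exact Nat.mul_le_mul_left _ (by omega)
  · intro s' _ h
    simpa using h

end Ram

namespace Ram

/-! ### The adjacency matrix -/

/-- The entry of the adjacency matrix in array `4` for the vertices in registers `i` and `j`. -/
def adjT (i j : ℕ) : Term :=
  .get 4 (.bin .add (.bin .mul (.var i) (.var 0)) (.var j))

/-- The entry of array `a` for the vertex in register `i`. -/
def flagT (a i : ℕ) : Term := .get a (.var i)

def andT (e f : Term) : Term := .bin .mul e f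

def notT (e : Term) : Term := .bin .eq e (.lit 0)

/-- Register `0` contains the number of vertices, array `4` the adjacency matrix. -/
structure HasMatrix {n : ℕ} (G : SimpleGraph (Fin n)) (s : State) : Prop where
  card : s.var 0 = n
  adj : ∀ u w : Fin n, s.arr 4 (u * n + w) = ind (G.Adj u w)

/-- Array `a` is the characteristic vector of `P`. -/
def Flags {n : ℕ} (s : State) (a : ℕ) (P : Fin n → Prop) : Prop :=
  ∀ v : Fin n, s.arr a v = ind (P v)

theorem Flags.congr {n : ℕ} {s s' : State} {a : ℕ} {P : Fin n → Prop} (h : Flags s a P)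
    (hs : s'.arr a = s.arr a) : Flags s' a P := fun v => by rw [hs, h v]

section Graph

variable {n : ℕ} {G : SimpleGraph (Fin n)} {s s' : State} {a i j : ℕ}

theorem HasMatrix.of_agree {p : Prog} (h : HasMatrix G s) (hs : Agree p s s')
    (hv : 0 ∉ p.vars) (ha : 4 ∉ p.arrs) : HasMatrix G s' :=
  ⟨(hs.var 0 hv).trans h.card, fun u w => by rw [hs.arr 4 ha, h.adj]⟩

/-- Leaves room for matrix indices below n², for products of two cardinalities, and for the small
literals even when n = 0. -/
theorem word_bound (n : ℕ) : n * n + 2 * n + 8 ≤ (n + 2) ^ 3 := by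
  nlinarith [Nat.zero_le (n ^ 3), Nat.zero_le (n ^ 2)]

theorem index_lt (u w : Fin n) : (u : ℕ) * n + w < n * n := by
  have h : ((u : ℕ) + 1) * n ≤ n * n := Nat.mul_le_mul_right n u.2
  have := w.2
  rw [Nat.add_mul, Nat.one_mul] at h
  omega

theorem index_inj {u w u' w' : Fin n} (h : (u : ℕ) * n + w = u' * n + w') : u = u' ∧ w = w' := by
  have hn : 0 < n := u.pos
  have h1 := congrArg (· / n) h
  have h2 := congrArg (· % n) h
  simp only [Nat.mul_comm _ n, Nat.mul_add_div hn, Nat.div_eq_of_lt w.2, Nat.div_eq_of_lt w'.2,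
    Nat.mul_add_mod, Nat.mod_eq_of_lt w.2, Nat.mod_eq_of_lt w'.2, Nat.add_zero] at h1 h2
  exact ⟨Fin.ext h1, Fin.ext h2⟩

theorem IsNum.adjT {u w : Fin n} (h : HasMatrix G s) (hi : s.var i = u) (hj : s.var j = w) :
    IsNum ((n + 2) ^ 3) s (adjT i j) (ind (G.Adj u w)) := by
  have hW := word_bound n
  have h1 := index_lt u w
  have h2 := ind_le_one (G.Adj u w)
  have hu := u.2
  have hw := w.2
  refine .get (.bin .add (.bin .mul (.var hi (by omega)) (.var h.card (by omega)) ?_)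
    (.var hj (by omega)) ?_) (h.adj u w) (by omega)
  · simp only [Op.val]; omega
  · simp only [Op.val]; omega

theorem IsNum.flagT {v : Fin n} {P : Fin n → Prop} (h : Flags s a P) (hi : s.var i = v) :
    IsNum ((n + 2) ^ 3) s (flagT a i) (ind (P v)) := by
  have hW := word_bound n
  have h2 := ind_le_one (P v)
  have hv := v.2
  exact .get (.var hi (by omega)) (h v) (by omega)

theorem IsNum.andT {W : ℕ} {e f : Term} {P P' : Prop} (hW : 1 < W) (he : IsNum W s e (ind P))
    (hf : IsNum W s f (ind P')) : IsNum W s (Ram.andT e f) (ind (P ∧ P')) := he.and hf hW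

theorem IsNum.notT {W : ℕ} {e : Term} {P : Prop} (hW : 1 < W) (he : IsNum W s e (ind P)) :
    IsNum W s (Ram.notT e) (ind (¬ P)) := he.not hW

theorem one_lt_word (n : ℕ) : 1 < (n + 2) ^ 3 := by have := word_bound n; omega

/-- Computes the adjacency matrix. -/
def buildMatrix : Prog :=
  forAll 1 (forRange 2 (.get 0 (.var 1)) (.get 0 (.bin .add (.var 1) (.lit 1)))
    (.put 4 (.bin .add (.bin .mul (.var 1) (.var 0)) (.get 1 (.var 2))) (.lit 1)))

/-- The list of v injects into the n vertices. Summed up, this keeps the offsets within a word and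
the row loops within n iterations. -/
theorem _root_.IsAdjList.off_succ_le {off adj : ℕ → ℕ} (h : IsAdjList G off adj) (v : Fin n) :
    off (v + 1) ≤ off v + n := by
  have hb := h.bijOn v
  have : (Finset.Ico (off v) (off (v + 1))).card ≤ (Finset.range n).card := by
    refine Finset.card_le_card_of_injOn adj (fun i hi => ?_) (by simpa using hb.injOn)
    obtain ⟨w, -, hw⟩ := hb.mapsTo (by simpa using hi)
    simp [← hw]
  simp only [Nat.card_Ico, Finset.card_range] at this
  omega

theorem _root_.IsAdjList.off_le {off adj : ℕ → ℕ} (h : IsAdjList G off adj) :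
    ∀ k ≤ n, off k ≤ k * n
  | 0, _ => by simp [h.zero]
  | k + 1, hk => by
    have h1 := h.off_succ_le ⟨k, hk⟩
    have h2 := h.off_le k (by omega)
    rw [Nat.add_mul, Nat.one_mul]
    exact h1.trans (by simpa using h2)

theorem Ex.buildMatrix {off adj : ℕ → ℕ} (h : IsAdjList G off adj) (hn : s.var 0 = n)
    (h0 : s.arr 0 = off) (h1 : s.arr 1 = adj) (h4 : ∀ i, s.arr 4 i = 0) :
    Ex ((n + 2) ^ 3) buildMatrix s ((n + 1) * ((n + 1) * 40)) (HasMatrix G) := by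
  have hW := word_bound n
  refine (Ex.forAll (n := n) (T := (n + 1) * 30) (fun k s' => ∀ u w : Fin n,
    s'.arr 4 (u * n + w) = ind (u.val < k ∧ G.Adj u w)) hn (by omega) (by decide) (by decide)
    (fun _ _ _ h => h) ?_ ?_).mono (Nat.mul_le_mul_left _ (by omega)) ?_
  · intro u w
    rw [h4, ind_of_not (by simp)]
  · intro k s₁ hs₁ hk₁ hinv
    have hoff : s₁.arr 0 = off := (hs₁.arr 0 (by decide)).trans h0
    have hle : ∀ m ≤ n, off m ≤ n * n := fun m hm =>
      (h.off_le m hm).trans (Nat.mul_le_mul_right n hm)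
    have ha := hle k k.2.le
    have hb := hle (k + 1) k.2
    have hkn := k.2
    -- Earlier rows are complete, and row k contains the list entries read so far.
    refine (Ex.forRange (a := off k) (b := off (k + 1)) (T := 8) (fun j s' => ∀ u w : Fin n,
      s'.arr 4 (u * n + w) = ind (u.val < k ∧ G.Adj u w ∨
        u = k ∧ ∃ i, off k ≤ i ∧ i < j ∧ adj i = w)) ?_ (h.mono k) (by omega) ?_ (by decide)
        (fun _ _ _ h => h) ?_ ?_).mono ?_ ?_
    · exact .get (.var hk₁ (by omega)) (by rw [hoff]) (by omega)
    · intro s₂ hs₂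
      have hk₂ : s₂.var 1 = k := (hs₂.var 1 (by decide)).trans hk₁
      have ho₂ : s₂.arr 0 = off := (hs₂.arr 0 (by decide)).trans hoff
      exact .get (.bin .add (.var hk₂ (by omega)) (.lit (by omega)) (by simp only [Op.val]; omega))
        (by rw [ho₂]; rfl) (by omega)
    · intro u w
      rw [hinv u w]
      refine ind_congr ⟨.inl, ?_⟩
      rintro (h | ⟨-, i, h1, h2, -⟩)
      exacts [h, by omega]
    · intro j s₂ hj hj' hs₂ hj₂ hinv₂
      have hk₂ : s₂.var 1 = k := (hs₂.var 1 (by decide)).trans hk₁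
      have hn₂ : s₂.var 0 = n :=
        (hs₂.var 0 (by decide)).trans ((hs₁.var 0 (by decide)).trans hn)
      have ha₂ : s₂.arr 1 = adj :=
        (hs₂.arr 1 (by decide)).trans ((hs₁.arr 1 (by decide)).trans h1)
      obtain ⟨x, hx, hxj⟩ := (h.bijOn k).mapsTo ⟨hj, hj'⟩
      have hidx := index_lt k x
      have hxn := x.2
      refine Ex.put (i := k * n + x) (k := 1) ?_ (.lit (by omega)) ?_
      · exact .bin .add (.bin .mul (.var hk₂ (by omega)) (.var hn₂ (by omega))
          (by simp only [Op.val]; omega)) (.get (.var hj₂ (by omega)) (by rw [ha₂, hxj])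
          (by omega)) (by simp only [Op.val]; omega)
      · intro u w
        rw [State.setArr_arr]
        by_cases huw : u = k ∧ w = x
        · obtain ⟨rfl, rfl⟩ := huw
          rw [if_pos ⟨rfl, rfl⟩, ind_of]
          exact .inr ⟨rfl, j, hj, by omega, hxj.symm⟩
        · rw [if_neg (fun h => huw (index_inj h.2)), hinv₂]
          refine ind_congr (or_congr_right (and_congr_right fun huk => ?_))
          constructor
          · rintro ⟨i, h1, h2, h3⟩
            exact ⟨i, h1, by omega, h3⟩
          · rintro ⟨i, h1, h2, h3⟩
            refine ⟨i, h1, ?_, h3⟩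
            rcases Nat.lt_succ_iff_lt_or_eq.1 h2 with h2 | rfl
            · exact h2
            · exact (huw ⟨huk, Fin.ext (h3.symm.trans hxj.symm)⟩).elim
    · have hdeg := h.off_succ_le k
      have : (off (k + 1) - off k + 1) * 19 ≤ (n + 1) * 19 := Nat.mul_le_mul_right _ (by omega)
      simp only [Term.cost]
      omega
    · intro s₂ _ hinv₂ u w
      rw [hinv₂ u w]
      refine ind_congr ?_
      rw [Nat.lt_succ_iff_lt_or_eq, or_and_right]
      refine or_congr_right ?_
      rw [Fin.val_inj]
      refine and_congr_right ?_
      rintro rfl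
      constructor
      · rintro ⟨i, hi1, hi2, hi3⟩
        obtain ⟨x, hx, hxi⟩ := (h.bijOn u).mapsTo ⟨hi1, hi2⟩
        rw [Fin.ext (hi3.symm.trans hxi.symm)]
        exact hx
      · intro huw
        obtain ⟨i, hi, hiw⟩ := (h.bijOn u).surjOn (Set.mem_image_of_mem _ huw)
        exact ⟨i, hi.1, hi.2, hiw⟩
  · intro s' hs' hinv
    refine ⟨(hs'.var 0 (by decide)).trans hn, fun u w => ?_⟩
    rw [hinv]
    exact ind_congr (by simp)

end Graph

end Ram

/-! ### Computing D and A -/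

namespace Ram

theorem card_filter_eq_zero {n : ℕ} {P : Fin n → Prop} [DecidablePred P] :
    (Finset.univ.filter P).card = 0 ↔ ¬ ∃ v, P v := by
  simp [Finset.filter_eq_empty_iff]

/-- Array `6` becomes the characteristic vector of the one-sided vertices, array `5` that of the
vertices far from both sides. -/
def classify : Prog :=
  forAll 1 (.seq (count 5 2 (andT (flagT 2 2) (adjT 1 2)))
    (.seq (count 6 2 (andT (flagT 3 2) (adjT 1 2)))
    (.seq (.put 6 (.var 1) (andT (andT (notT (flagT 2 1)) (notT (flagT 3 1)))
        (notT (.bin .eq (notT (.var 5)) (notT (.var 6))))))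
      (.put 5 (.var 1) (andT (andT (notT (flagT 2 1)) (notT (flagT 3 1)))
        (andT (notT (.var 5)) (notT (.var 6))))))))

/-- Array `5` becomes the characteristic vector of the outer vertices. -/
def restrictOuter : Prog :=
  forAll 1 (.seq (count 5 2 (andT (flagT 6 2) (adjT 1 2)))
    (.put 5 (.var 1) (andT (flagT 5 1) (.bin .lt (.lit 0) (.var 5)))))

section Graph

variable {n : ℕ} {G : SimpleGraph (Fin n)} {s : State} {X Y : Finset (Fin n)}

/-- The form tested by the program: "exactly one side" is the inequality of two emptiness flags. -/
theorem mem_oneSided_iff {d : Fin n} : d ∈ oneSided G X Y ↔ (d ∉ X ∧ d ∉ Y) ∧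
    ¬ ((¬ ∃ x, x ∈ X ∧ G.Adj d x) ↔ ¬ ∃ y, y ∈ Y ∧ G.Adj d y) := by
  rw [mem_oneSided]
  constructor
  · rintro (⟨h1, h2, ⟨x, hx, hdx⟩, h4⟩ | ⟨h1, h2, ⟨x, hx, hdx⟩, h4⟩)
    · exact ⟨⟨h1, h2⟩, fun h => h.2 (fun ⟨y, hy, hdy⟩ => h4 y hy hdy) ⟨x, hx, hdx⟩⟩
    · exact ⟨⟨h2, h1⟩, fun h => h.1 (fun ⟨y, hy, hdy⟩ => h4 y hy hdy) ⟨x, hx, hdx⟩⟩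
  · rintro ⟨⟨h1, h2⟩, h⟩
    by_cases hx : ∃ x, x ∈ X ∧ G.Adj d x
    · have hy : ¬ ∃ y, y ∈ Y ∧ G.Adj d y := fun hy => h (iff_of_false (not_not.2 hx) (not_not.2 hy))
      exact .inl ⟨h1, h2, hx, fun y hyY hdy => hy ⟨y, hyY, hdy⟩⟩
    · have hy : ∃ y, y ∈ Y ∧ G.Adj d y := by
        by_contra hy
        exact h (iff_of_true hx hy)
      exact .inr ⟨h2, h1, hy, fun y hyX hdy => hx ⟨y, hyX, hdy⟩⟩

theorem farFrom_iff {v : Fin n} : FarFrom G (X : Set (Fin n)) (Y : Set (Fin n)) v ↔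
    (v ∉ X ∧ v ∉ Y) ∧ (¬ ∃ x, x ∈ X ∧ G.Adj v x) ∧ ¬ ∃ y, y ∈ Y ∧ G.Adj v y := by
  constructor
  · rintro ⟨h1, h2, h3, h4⟩
    exact ⟨⟨h1, h2⟩, fun ⟨x, hx, h⟩ => h3 x hx h, fun ⟨x, hx, h⟩ => h4 x hx h⟩
  · rintro ⟨⟨h1, h2⟩, h3, h4⟩
    exact ⟨h1, h2, fun x hx h => h3 ⟨x, hx, h⟩, fun x hx h => h4 ⟨x, hx, h⟩⟩

/-- Counting the vertices `w` with `P w` that are adjacent to the vertex in register `1`. -/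
theorem Ex.count_adj {r a : ℕ} {P : Fin n → Prop} {v : Fin n} (hG : HasMatrix G s)
    (ha : Flags s a P) (hv : s.var 1 = v) (hr : r ≠ 0 ∧ r ≠ 1 ∧ r ≠ 2) :
    Ex ((n + 2) ^ 3) (Ram.count r 2 (andT (flagT a 2) (adjT 1 2))) s ((n + 1) * 29) fun s' =>
      ∃ c ≤ n, s'.var r = c ∧ (c = 0 ↔ ¬ ∃ w, P w ∧ G.Adj v w) := by
  classical
  have hW := word_bound n
  refine (Ex.count (fun w => P w ∧ G.Adj v w) hG.card (by omega) hr.2.2 hr.1 (by decide)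
    fun w s' hs' hw => ?_).mono ?_ fun s' _ h => ⟨_, ?_, h, card_filter_eq_zero⟩
  · have hvars : ∀ x, x ≠ r → x ≠ 2 → s'.var x = s.var x := fun x hx hx2 =>
      hs'.var x (by simp [Ram.count, Ram.forAll, Ram.forRange, Prog.vars, hx, hx2])
    have harrs : ∀ x, s'.arr x = s.arr x := fun x =>
      hs'.arr x (by simp [Ram.count, Ram.forAll, Ram.forRange, Prog.arrs])
    refine .andT (one_lt_word n) (.flagT (ha.congr (harrs a)) hw) (.adjT ⟨?_, fun u w => ?_⟩ ?_ hw)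
    · rw [hvars 0 hr.1.symm (by decide), hG.card]
    · rw [harrs, hG.adj]
    · rw [hvars 1 hr.2.1.symm (by decide), hv]
  · simp [Term.cost, andT, flagT, adjT]
  · exact (Finset.card_le_univ _).trans_eq (Fintype.card_fin n)

theorem Ex.classify (hG : HasMatrix G s) (hX : Flags s 2 (· ∈ X)) (hY : Flags s 3 (· ∈ Y)) :
    Ex ((n + 2) ^ 3) classify s ((n + 1) * ((n + 1) * 150)) fun s' =>
      Flags s' 6 (· ∈ oneSided G X Y) ∧
        Flags s' 5 (FarFrom G (X : Set (Fin n)) (Y : Set (Fin n))) := by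
  have hW := word_bound n
  have h1W := one_lt_word n
  refine (Ex.forAll (n := n) (T := (n + 1) * 140) (fun k s' => ∀ v : Fin n, v.val < k →
    s'.arr 6 v = ind (v ∈ oneSided G X Y) ∧
    s'.arr 5 v = ind (FarFrom G (X : Set (Fin n)) (Y : Set (Fin n)) v)) hG.card (by omega)
    (by decide) (by decide) (fun _ _ _ h => h) (by simp) ?_).mono
    (Nat.mul_le_mul_left _ (by omega)) fun s' _ h => ⟨fun v => (h v v.2).1, fun v => (h v v.2).2⟩
  intro k s₁ hs₁ hk₁ hinv
  have hkn := k.2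
  have hG₁ := hG.of_agree hs₁ (by decide) (by decide)
  have hX₁ := hX.congr (hs₁.arr 2 (by decide))
  have hY₁ := hY.congr (hs₁.arr 3 (by decide))
  refine Ex.mono ((Ex.count_adj hG₁ hX₁ hk₁ (by decide)).seq (T' := (n + 1) * 29 + (27 + 26))
    fun s₂ hs₂ h₂ => ?_) (by omega) fun _ _ h => h
  obtain ⟨c, hcn, hc, hc0⟩ := h₂
  have hk₂ := (hs₂.var 1 (by decide)).trans hk₁
  have hG₂ := hG₁.of_agree hs₂ (by decide) (by decide)
  have hX₂ := hX₁.congr (hs₂.arr 2 (by decide))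
  have hY₂ := hY₁.congr (hs₂.arr 3 (by decide))
  refine (Ex.count_adj hG₂ hY₂ hk₂ (by decide)).seq fun s₃ hs₃ h₃ => ?_
  obtain ⟨e, hen, he, he0⟩ := h₃
  have hk₃ := (hs₃.var 1 (by decide)).trans hk₂
  have hc₃ := (hs₃.var 5 (by decide)).trans hc
  have hX₃ := hX₂.congr (hs₃.arr 2 (by decide))
  have hY₃ := hY₂.congr (hs₃.arr 3 (by decide))
  have hc₃' : IsNum ((n + 2) ^ 3) s₃ (notT (.var 5)) (ind (¬ ∃ x, x ∈ X ∧ G.Adj k x)) :=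
    ((IsNum.var hc₃ (by omega)).eq (.lit (by omega)) h1W).congr hc0
  have he₃' : IsNum ((n + 2) ^ 3) s₃ (notT (.var 6)) (ind (¬ ∃ x, x ∈ Y ∧ G.Adj k x)) :=
    ((IsNum.var he (by omega)).eq (.lit (by omega)) h1W).congr he0
  have hXY₃ : IsNum ((n + 2) ^ 3) s₃ (andT (notT (flagT 2 1)) (notT (flagT 3 1)))
      (ind (k ∉ X ∧ k ∉ Y)) :=
    .andT h1W (.notT h1W (.flagT hX₃ hk₃)) (.notT h1W (.flagT hY₃ hk₃))
  refine Ex.mono ((Ex.put (IsNum.var hk₃ (by omega)) ((IsNum.andT h1W hXY₃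
    (.notT h1W (hc₃'.iff he₃' h1W))).congr mem_oneSided_iff.symm)
    (Q := fun s => s = s₃.setArr 6 k (ind (k ∈ oneSided G X Y))) rfl).seq
    (T' := 26) ?_) (by decide) fun _ _ h => h
  rintro s₄ - rfl
  refine Ex.mono (Ex.put (IsNum.var (k := k) hk₃ (by omega)) ((IsNum.andT h1W (P := k ∉ X ∧ k ∉ Y)
    (P' := (¬ ∃ x, x ∈ X ∧ G.Adj k x) ∧ (¬ ∃ x, x ∈ Y ∧ G.Adj k x)) ?_
    (.andT h1W ?_ ?_)).congr farFrom_iff.symm) ?_) ?_ fun _ _ h => h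
  · exact .andT h1W (.notT h1W (.flagT hX₃ hk₃)) (.notT h1W (.flagT hY₃ hk₃))
  · exact ((IsNum.var hc₃ (by omega)).eq (.lit (by omega)) h1W).congr hc0
  · exact ((IsNum.var he (by omega)).eq (.lit (by omega)) h1W).congr he0
  · intro v hv
    simp only [State.setArr_arr, Fin.val_inj]
    by_cases hvk : v = k
    · subst hvk; simp
    · have hlt : v.val < k := by
        have := Fin.val_ne_of_ne hvk
        omega
      have h6 : s₃.arr 6 = s₁.arr 6 := (hs₃.arr 6 (by decide)).trans (hs₂.arr 6 (by decide))
      have h5 : s₃.arr 5 = s₁.arr 5 := (hs₃.arr 5 (by decide)).trans (hs₂.arr 5 (by decide))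
      simpa [hvk, h5, h6] using hinv v hlt
  · decide

/-- Array `5` is overwritten in place, so the invariant describes treated and untreated cells
separately. -/
theorem Ex.restrictOuter (hG : HasMatrix G s)
    (hD : Flags s 6 (· ∈ oneSided G X Y))
    (hF : Flags s 5 (FarFrom G (X : Set (Fin n)) (Y : Set (Fin n)))) :
    Ex ((n + 2) ^ 3) restrictOuter s ((n + 1) * ((n + 1) * 70)) fun s' =>
      Flags s' 5 (· ∈ outerVertices G X Y) := by
  have hW := word_bound n
  have h1W := one_lt_word n
  refine (Ex.forAll (n := n) (T := (n + 1) * 60) (fun k s' => ∀ v : Fin n,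
    (v.val < k → s'.arr 5 v = ind (v ∈ outerVertices G X Y)) ∧
    (k ≤ v.val → s'.arr 5 v = ind (FarFrom G (X : Set (Fin n)) (Y : Set (Fin n)) v)))
    hG.card (by omega) (by decide) (by decide) (fun _ _ _ h => h) ?_ ?_).mono
    (Nat.mul_le_mul_left _ (by omega)) fun s' _ h v => (h v).1 v.2
  · exact fun v => ⟨fun h => (Nat.not_lt_zero _ h).elim, fun _ => hF v⟩
  intro k s₁ hs₁ hk₁ hinv
  have hkn := k.2
  have hG₁ := hG.of_agree hs₁ (by decide) (by decide)
  have hD₁ := hD.congr (hs₁.arr 6 (by decide))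
  refine Ex.mono ((Ex.count_adj hG₁ hD₁ hk₁ (by decide)).seq (T' := 20)
    fun s₂ hs₂ h₂ => ?_) (by omega) fun _ _ h => h
  obtain ⟨c, hcn, hc, hc0⟩ := h₂
  have hk₂ := (hs₂.var 1 (by decide)).trans hk₁
  have h5 : s₂.arr 5 = s₁.arr 5 := hs₂.arr 5 (by decide)
  have hle := ind_le_one (FarFrom G (X : Set (Fin n)) (Y : Set (Fin n)) k)
  refine Ex.mono (Ex.put (IsNum.var (k := k) hk₂ (by omega)) ((IsNum.andT h1W
    (P := FarFrom G (X : Set (Fin n)) (Y : Set (Fin n)) k)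
    (P' := 0 < c) (.get (.var hk₂ (by omega)) ?_ (by omega))
    (.lt (.lit (by omega)) (.var hc (by omega)) h1W)).congr
    (P' := k ∈ outerVertices G X Y) ?_) ?_) (by decide) fun _ _ h => h
  · rw [h5, (hinv k).2 le_rfl]
  · rw [mem_outerVertices, Nat.pos_iff_ne_zero, Ne, hc0, not_not]
  · intro v
    simp only [State.setArr_arr, Fin.val_inj]
    by_cases hvk : v = k
    · subst hvk; simp
    · have := Fin.val_ne_of_ne hvk
      simp only [hvk, and_false, if_false, h5]
      exact ⟨fun h => (hinv v).1 (by omega), fun h => (hinv v).2 (by omega)⟩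

/-! ### Deletion of twins -/

/-- Deletes vertices of the set in array `5` until it induces a matching with isolated vertices. -/
def deleteTwins : Prog :=
  forAll 1 (.ite (flagT 5 1) (.seq (.set 5 (.lit 0))
    (forAll 2 (.ite (andT (flagT 5 2) (adjT 1 2))
      (.ite (.var 5) (.put 5 (.var 2) (.lit 0)) (.set 5 (.lit 1))) .skip))) .skip)

theorem Flags.erase {A : Finset (Fin n)} {a : ℕ} {v : Fin n} (h : Flags s a (· ∈ A)) :
    Flags (s.setArr a v 0) a (· ∈ A.erase v) := by
  intro u
  rw [State.setArr_arr, h u]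
  by_cases huv : u = v
  · subst huv; simp [ind_of_not]
  · rw [if_neg (fun h => huv (Fin.ext h.2))]
    exact ind_congr (by simp [huv])

/-- For each v still present, the first neighbour found is kept and the later ones are deleted.
Deletions only shrink A, so vertices treated earlier keep at most one neighbour. -/
theorem Ex.deleteTwins {A D : Finset (Fin n)} (hG : HasMatrix G s) (hA : Flags s 5 (· ∈ A))
    (hT : TwinStructure G A D) :
    Ex ((n + 2) ^ 3) deleteTwins s ((n + 1) * ((n + 1) * 60)) fun s' =>
      ∃ A' ⊆ A, Flags s' 5 (· ∈ A') ∧ InducesMatching G A' ∧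
        (HasIndepDominating G A' D ↔ HasIndepDominating G A D) := by
  have hW := word_bound n
  have h1W := one_lt_word n
  refine (Ex.forAll (n := n) (T := (n + 1) * 50) (fun k s' =>
      ∃ A' ⊆ A, Flags s' 5 (· ∈ A') ∧ (HasIndepDominating G A' D ↔ HasIndepDominating G A D) ∧
        ∀ v ∈ A', v.val < k → ∀ w ∈ A', ∀ u ∈ A', G.Adj v w → G.Adj v u → w = u) hG.card
    (by omega) (by decide) (by decide) (fun _ _ _ h => h)
    ⟨A, subset_rfl, hA, Iff.rfl, fun _ _ h => (Nat.not_lt_zero _ h).elim⟩ ?_).mono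
    (Nat.mul_le_mul_left _ (by omega))
    fun s' _ ⟨A', h1, h2, h3, h4⟩ => ⟨A', h1, h2, fun v hv => h4 v hv v.2, h3⟩
  rintro v s₁ hs₁ hv₁ ⟨A₁, hA₁A, hA₁, hiff₁, hm₁⟩
  have hvn := v.2
  have hG₁ := hG.of_agree hs₁ (by decide) (by decide)
  refine Ex.mono (Ex.ite (.flagT hA₁ hv₁) (T := 2 + (n + 1) * 40) (T' := 1) (fun hvA => ?_)
    fun hvA => Ex.skip ?_) (by simp [Term.cost, flagT]; omega) fun _ _ h => h
  swap
  · rw [ind_eq_zero] at hvA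
    refine ⟨A₁, hA₁A, hA₁, hiff₁, fun u hu huv => ?_⟩
    rcases Nat.lt_succ_iff_lt_or_eq.1 huv with h | h
    · exact hm₁ u hu h
    · exact (hvA (Fin.ext h ▸ hu)).elim
  rw [ind_ne_zero] at hvA
  refine Ex.seq (Q' := fun s => s = s₁.setVar 5 0) (.set (.lit (by omega)) rfl) ?_
  rintro s₂ hs₂ rfl
  -- Register `5` records whether a neighbour of v has been kept already; v itself survives because
  -- only its neighbours are deleted.
  refine (Ex.forAll (n := n) (T := 30) (fun k s' =>
      ∃ A' ⊆ A₁, Flags s' 5 (· ∈ A') ∧ (HasIndepDominating G A' D ↔ HasIndepDominating G A D) ∧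
        v ∈ A' ∧ s'.var 5 = ind (∃ w ∈ A', w.val < k ∧ G.Adj v w) ∧
        ∀ w ∈ A', ∀ u ∈ A', w.val < k → u.val < k → G.Adj v w → G.Adj v u → w = u) ?_
    (by omega) (by decide) (by decide) (fun _ _ _ h => by exact h) ?_ ?_).mono
    (Nat.mul_le_mul_left _ (by omega)) ?_
  · exact hG₁.card
  · exact ⟨A₁, subset_rfl, hA₁, hiff₁, hvA, by rw [ind_of_not (by simp)]; rfl,
      fun _ _ _ _ h => (Nat.not_lt_zero _ h).elim⟩
  · rintro u s₃ hs₃ hu₃ ⟨A₂, hA₂A, hA₂, hiff₂, hvA₂, hf, hm₂⟩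
    have hun := u.2
    have hG₃ := (hG₁.of_agree hs₂ (by decide) (by decide)).of_agree hs₃ (by decide) (by decide)
    have hv₃ : s₃.var 1 = v := (hs₃.var 1 (by decide)).trans hv₁
    have hsplit : ∀ w : Fin n, w.val < u.val + 1 → w.val < u.val ∨ w = u := fun w hw =>
      (Nat.lt_succ_iff_lt_or_eq.1 hw).imp_right Fin.ext
    refine Ex.mono (Ex.ite (IsNum.andT h1W (.flagT hA₂ hu₃) (.adjT hG₃ hv₃ hu₃))
      (T := 8) (T' := 1) (fun h => ?_) fun h => ?_)
      (by simp [Term.cost, flagT, andT, adjT]) fun _ _ h => h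
    · rw [ind_ne_zero] at h
      obtain ⟨huA, hvu⟩ := h
      refine Ex.mono (Ex.ite (IsNum.var hf ?_) (T := 3) (T' := 2) (fun h => ?_) fun h => ?_)
        (by simp [Term.cost]) fun _ _ h => h
      · exact (ind_le_one _).trans_lt h1W
      · rw [ind_ne_zero] at h
        obtain ⟨w, hw, hwu, hvw⟩ := h
        refine Ex.put (.var hu₃ (by omega)) (.lit (by omega)) ?_
        have hwu' : w ≠ u := by rintro rfl; exact lt_irrefl _ hwu
        refine ⟨A₂.erase u, (Finset.erase_subset _ _).trans hA₂A, hA₂.erase, ?_,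
          Finset.mem_erase.2 ⟨hvu.ne, hvA₂⟩, ?_, ?_⟩
        · exact ((hT.mono (hA₂A.trans hA₁A)).hasIndepDominating_erase hvA₂ hw huA hwu' hvw
            hvu).trans hiff₂
        · rw [State.setArr_var, hf, ind_of ⟨w, hw, hwu, hvw⟩, ind_of]
          exact ⟨w, Finset.mem_erase.2 ⟨hwu', hw⟩, by omega, hvw⟩
        · intro x hx y hy hxu hyu
          obtain ⟨hxu', hx⟩ := Finset.mem_erase.1 hx
          obtain ⟨hyu', hy⟩ := Finset.mem_erase.1 hy
          exact hm₂ x hx y hy ((hsplit x hxu).resolve_right hxu')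
            ((hsplit y hyu).resolve_right hyu')
      · rw [ind_eq_zero] at h
        refine Ex.set (.lit (by omega)) ⟨A₂, hA₂A, hA₂, hiff₂, hvA₂, ?_, ?_⟩
        · rw [State.setVar_var_self, ind_of]
          exact ⟨u, huA, by omega, hvu⟩
        · intro x hx y hy hxu hyu hvx hvy
          rcases hsplit x hxu with hxu | rfl
          · exact (h ⟨x, hx, hxu, hvx⟩).elim
          rcases hsplit y hyu with hyu | rfl
          · exact (h ⟨y, hy, hyu, hvy⟩).elim
          rfl
    · rw [ind_eq_zero, not_and] at h
      refine Ex.skip ⟨A₂, hA₂A, hA₂, hiff₂, hvA₂, ?_, ?_⟩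
      · rw [hf]
        refine ind_congr ⟨fun ⟨w, hw, hwu, hvw⟩ => ⟨w, hw, by omega, hvw⟩, ?_⟩
        rintro ⟨w, hw, hwu, hvw⟩
        rcases hsplit w hwu with hwu | rfl
        exacts [⟨w, hw, hwu, hvw⟩, (h hw hvw).elim]
      · intro x hx y hy hxu hyu hvx hvy
        rcases hsplit x hxu with hxu | rfl
        swap
        · exact (h hx hvx).elim
        rcases hsplit y hyu with hyu | rfl
        swap
        · exact (h hy hvy).elim
        exact hm₂ x hx y hy hxu hyu hvx hvy
  · rintro s₄ - ⟨A₂, hA₂A, hA₂, hiff₂, hvA₂, -, hm₂⟩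
    refine ⟨A₂, hA₂A.trans hA₁A, hA₂, hiff₂, fun x hx hxv w hw u hu hxw hxu => ?_⟩
    rcases Nat.lt_succ_iff_lt_or_eq.1 hxv with h | h
    · exact hm₁ x (hA₂A hx) h w (hA₂A hw) u (hA₂A hu) hxw hxu
    · obtain rfl := Fin.ext h
      exact hm₂ w hw u hu w.2 u.2 hxw hxu

end Graph

end Ram

namespace Ram

/-! ### Putting vertices into the independent set -/

/-- Array `7` receives the numbers of neighbours in the set in array `6`. -/
def computeDegrees : Prog :=
  forAll 1 (.seq (count 5 2 (andT (flagT 6 2) (adjT 1 2))) (.put 7 (.var 1) (.var 5)))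

/-- Searches for a critical vertex, to be written to register `7`. -/
def findCritical : Prog :=
  forAll 1 (.ite (flagT 6 1)
    (.seq (count 5 2 (andT (andT (flagT 5 2) (adjT 1 2)) (.bin .eq (flagT 7 2) (.lit 1))))
    (.seq (.set 6 (.var 0))
    (.seq (scan 6 2 (andT (flagT 5 2) (adjT 1 2)))
    (.seq (scan 6 2 (andT (andT (flagT 5 2) (adjT 1 2)) (.bin .lt (.lit 1) (flagT 7 2))))
    (.ite (andT (.bin .lt (.var 5) (.lit 2)) (.bin .lt (.var 6) (.var 0)))
      (.set 7 (.var 6)) .skip))))) .skip)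

/-- Searches for a dominant vertex, to be written to register `7`. -/
def findDominant : Prog :=
  forAll 1 (.ite (flagT 5 1)
    (.seq (.set 6 (.var 1))
    (.seq (scan 6 2 (andT (flagT 5 2) (adjT 1 2)))
    (.seq (count 5 2 (andT (andT (flagT 6 2) (adjT 6 2)) (notT (adjT 1 2))))
    (.ite (.var 5) .skip (.set 7 (.var 1)))))) .skip)

/-- Puts the vertex in register `7`, if there is one, into the independent set. -/
def applySelection : Prog :=
  .ite (.bin .lt (.var 7) (.var 0))
    (.seq (forAll 2 (.seq (.put 5 (.var 2) (andT (flagT 5 2) (notT (adjT 7 2))))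
      (.put 6 (.var 2) (andT (flagT 6 2) (notT (adjT 7 2))))))
    (.put 5 (.var 7) (.lit 0))) .skip

def selectionRound : Prog :=
  .seq (.set 7 (.var 0)) (.seq computeDegrees (.seq findCritical (.seq findDominant applySelection)))

section Graph

set_option linter.unusedSectionVars false

variable {n : ℕ} {G : SimpleGraph (Fin n)} [DecidableRel G.Adj] {s : State}
  {A D : Finset (Fin n)}

theorem lt_succ_cases {u w : Fin n} (h : w.val < u.val + 1) : w.val < u.val ∨ w = u :=
  (Nat.lt_succ_iff_lt_or_eq.1 h).imp_right Fin.ext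

theorem degIn_eq (v : Fin n) :
    (Finset.univ.filter fun d => d ∈ D ∧ G.Adj v d).card = degIn G D v :=
  congrArg Finset.card (by ext; simp)

theorem degIn_le (v : Fin n) : degIn G D v ≤ n :=
  (Finset.card_le_univ _).trans_eq (Fintype.card_fin n)

theorem Ex.computeDegrees (hG : HasMatrix G s) (hD : Flags s 6 (· ∈ D)) :
    Ex ((n + 2) ^ 3) computeDegrees s ((n + 1) * ((n + 1) * 60)) fun s' =>
      ∀ v : Fin n, s'.arr 7 v = degIn G D v := by
  have hW := word_bound n
  refine (Ex.forAll (n := n) (T := (n + 1) * 50) (fun k s' => ∀ v : Fin n, v.val < k →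
    s'.arr 7 v = degIn G D v) hG.card (by omega) (by decide) (by decide) (fun _ _ _ h => h)
    (by simp) ?_).mono (Nat.mul_le_mul_left _ (by omega)) fun s' _ h v => h v v.2
  intro k s₁ hs₁ hk₁ hinv
  have hkn := k.2
  have hG₁ := hG.of_agree hs₁ (by decide) (by decide)
  have hD₁ := hD.congr (hs₁.arr 6 (by decide))
  refine Ex.mono ((Ex.count (fun d => d ∈ D ∧ G.Adj k d) hG₁.card (by omega) (by decide)
    (by decide) (by decide) fun w s' hs' hw => ?_).seq (T' := 3) fun s₂ hs₂ h₂ => ?_)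
    (by simp [Term.cost, andT, flagT, adjT]; omega) fun _ _ h => h
  · exact .andT (one_lt_word n) (.flagT (hD₁.congr (hs'.arr 6 (by decide))) hw)
      (.adjT (hG₁.of_agree hs' (by decide) (by decide)) ((hs'.var 1 (by decide)).trans hk₁) hw)
  · rw [degIn_eq] at h₂
    have hle := degIn_le (G := G) (D := D) k
    have hk₂ := (hs₂.var 1 (by decide)).trans hk₁
    refine Ex.put (.var hk₂ (by omega)) (.var h₂ (by omega)) fun v hv => ?_
    rw [State.setArr_arr]
    rcases lt_succ_cases hv with hv | rfl
    · rw [if_neg (by omega), hs₂.arr 7 (by decide), hinv v hv]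
    · rw [if_pos ⟨rfl, rfl⟩]

theorem IsNum.deg {i : ℕ} {v : Fin n} (h : ∀ v : Fin n, s.arr 7 v = degIn G D v)
    (hi : s.var i = v) : IsNum ((n + 2) ^ 3) s (Ram.flagT 7 i) (degIn G D v) := by
  have hW := word_bound n
  have h2 := degIn_le (G := G) (D := D) v
  have hv := v.2
  exact .get (.var hi (by omega)) (h v) (by omega)

theorem soleNeighbors_card (d : Fin n) :
    (Finset.univ.filter fun v => (v ∈ A ∧ G.Adj d v) ∧ degIn G D v = 1).card =
      (soleNeighbors G A D d).card :=
  congrArg Finset.card (by ext; simp [soleNeighbors, and_assoc])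

theorem Ex.findCritical (hG : HasMatrix G s) (hA : Flags s 5 (· ∈ A)) (hD : Flags s 6 (· ∈ D))
    (hdeg : ∀ v : Fin n, s.arr 7 v = degIn G D v) (h7 : s.var 7 = n) :
    Ex ((n + 2) ^ 3) findCritical s ((n + 1) * ((n + 1) * 180)) fun s' =>
      (∃ c : Fin n, (∃ d, IsCritical G A D d c) ∧ s'.var 7 = c) ∨
        (∀ c d, ¬ IsCritical G A D d c) ∧ s'.var 7 = n := by
  have hW := word_bound n
  have h1W := one_lt_word n
  refine (Ex.forAll (n := n) (T := (n + 1) * 170) (fun k s' =>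
      (∃ c : Fin n, (∃ d, IsCritical G A D d c) ∧ s'.var 7 = c) ∨
        (∀ d : Fin n, d.val < k → ∀ c, ¬ IsCritical G A D d c) ∧ s'.var 7 = n) hG.card (by omega)
    (by decide) (by decide) (fun _ _ _ h => by exact h) (.inr ⟨by simp, h7⟩) ?_).mono
    (Nat.mul_le_mul_left _ (by omega))
    fun s' _ h => h.imp_right fun h => ⟨fun c d => h.1 d d.2 c, h.2⟩
  intro d s₁ hs₁ hd₁ hinv
  have hdn := d.2
  have hG₁ := hG.of_agree hs₁ (by decide) (by decide)
  have hA₁ := hA.congr (hs₁.arr 5 (by decide))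
  have hD₁ := hD.congr (hs₁.arr 6 (by decide))
  have hdeg₁ : ∀ v : Fin n, s₁.arr 7 v = degIn G D v := fun v => by
    rw [hs₁.arr 7 (by decide), hdeg v]
  have hskip : (∀ c, ¬ IsCritical G A D d c) →
      (∃ c : Fin n, (∃ d, IsCritical G A D d c) ∧ s₁.var 7 = c) ∨
        (∀ e : Fin n, e.val < d.val + 1 → ∀ c, ¬ IsCritical G A D e c) ∧ s₁.var 7 = n :=
    fun hno => hinv.imp_right fun h => ⟨fun e he => by
      rcases lt_succ_cases he with he | rfl
      exacts [h.1 e he, hno], h.2⟩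
  refine Ex.mono (Ex.ite (.flagT hD₁ hd₁) (T := (n + 1) * 34 + (2 + ((n + 1) * 29 +
    ((n + 1) * 34 + 12)))) (T' := 1) (fun hdD => ?_) fun hdD => Ex.skip ?_)
    (by simp [Term.cost, flagT]; omega) fun _ _ h => h
  swap
  · rw [ind_eq_zero] at hdD
    exact hskip fun c hc => hdD hc.1
  rw [ind_ne_zero] at hdD
  refine (Ex.mono (Ex.count (fun v => (v ∈ A ∧ G.Adj d v) ∧ degIn G D v = 1) hG₁.card (by omega)
    (by decide) (by decide) (by decide) fun w s' hs' hw => ?_) (by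
      simp [Term.cost, andT, flagT, adjT]) fun _ _ h => h).seq fun s₂ hs₂ h₂ => ?_
  · refine .andT h1W (.andT h1W (.flagT (hA₁.congr (hs'.arr 5 (by decide))) hw)
      (.adjT (hG₁.of_agree hs' (by decide) (by decide)) ((hs'.var 1 (by decide)).trans hd₁) hw))
      (.eq (.deg (fun v => ?_) hw) (.lit (by omega)) h1W)
    rw [hs'.arr 7 (by decide), hdeg₁]
  rw [soleNeighbors_card] at h₂
  have hG₂ := hG₁.of_agree hs₂ (by decide) (by decide)
  refine Ex.seq (Q' := fun s => s = s₂.setVar 6 n)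
    (.set (.var hG₂.card (by omega)) rfl) ?_
  rintro s₃ hs₃ rfl
  have hG₃ := hG₂.of_agree hs₃ (by decide) (by decide)
  have hA₃ : Flags (s₂.setVar 6 n) 5 (· ∈ A) := hA₁.congr (hs₂.arr 5 (by decide))
  have hd₃ := ((hs₃.var 1 (by decide)).trans (hs₂.var 1 (by decide))).trans hd₁
  refine (Ex.mono (Ex.scan (fun v => v ∈ A ∧ G.Adj d v) hG₃.card (by omega)
    (by decide) (by decide) (by decide) fun w s' hs' hw => ?_) (by
      simp [Term.cost, andT, flagT, adjT]) fun _ _ h => h).seq fun s₄ hs₄ h₄ => ?_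
  · exact .andT h1W (.flagT (hA₃.congr (hs'.arr 5 (by decide))) hw)
      (.adjT (hG₃.of_agree hs' (by decide) (by decide)) ((hs'.var 1 (by decide)).trans hd₃) hw)
  have hG₄ := hG₃.of_agree hs₄ (by decide) (by decide)
  have hA₄ := hA₃.congr (hs₄.arr 5 (by decide))
  have hd₄ := (hs₄.var 1 (by decide)).trans hd₃
  have hdeg₄ : ∀ v : Fin n, s₄.arr 7 v = degIn G D v := fun v => by
    rw [hs₄.arr 7 (by decide), hs₃.arr 7 (by decide), hs₂.arr 7 (by decide), hdeg₁]
  refine (Ex.mono (Ex.scan (fun v => (v ∈ A ∧ G.Adj d v) ∧ 1 < degIn G D v) hG₄.card (by omega)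
    (by decide) (by decide) (by decide) fun w s' hs' hw => ?_) (by
      simp [Term.cost, andT, flagT, adjT]) fun _ _ h => h).seq fun s₅ hs₅ h₅ => ?_
  · refine .andT h1W (.andT h1W (.flagT (hA₄.congr (hs'.arr 5 (by decide))) hw)
      (.adjT (hG₄.of_agree hs' (by decide) (by decide)) ((hs'.var 1 (by decide)).trans hd₄) hw))
      (.lt (.lit (by omega)) (.deg (fun v => ?_) hw) h1W)
    rw [hs'.arr 7 (by decide), hdeg₄]
  have hG₅ := hG₄.of_agree hs₅ (by decide) (by decide)
  have hcount : s₅.var 5 = (soleNeighbors G A D d).card := by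
    rw [hs₅.var 5 (by decide), hs₄.var 5 (by decide), hs₃.var 5 (by decide), h₂]
  have hseven : s₅.var 7 = s₁.var 7 := by
    rw [hs₅.var 7 (by decide), hs₄.var 7 (by decide), hs₃.var 7 (by decide),
      hs₂.var 7 (by decide)]
  -- The second search overwrites the first only with a vertex of degree at least 2. If it fails,
  -- all degrees are at most 1 and any neighbour will do; the value n survives only if there is no
  -- neighbour.
  have hz : (∃ z : Fin n, s₅.var 6 = z ∧ (z ∈ A ∧ G.Adj d z) ∧
      (degIn G D z ≤ 1 → ∀ w ∈ A, G.Adj d w → degIn G D w ≤ 1)) ∨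
      s₅.var 6 = n ∧ ∀ z, ¬ (z ∈ A ∧ G.Adj d z) := by
    rcases h₅ with ⟨z, ⟨h, hlt⟩, hz⟩ | ⟨hall, hz⟩
    · exact .inl ⟨z, hz, h, fun h => by omega⟩
    · have hall' : ∀ w ∈ A, G.Adj d w → degIn G D w ≤ 1 := fun w hw hdw => by
        have := hall w
        push Not at this
        exact this ⟨hw, hdw⟩
      rcases h₄ with ⟨z, h, hz'⟩ | ⟨hno, hz'⟩
      · exact .inl ⟨z, hz.trans hz', h, fun _ => hall'⟩
      · exact .inr ⟨hz.trans (hz'.trans (by simp)), hno⟩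
  have hcn : (soleNeighbors G A D d).card ≤ n :=
    (Finset.card_le_univ _).trans_eq (Fintype.card_fin n)
  have h6n : s₅.var 6 ≤ n := by
    rcases hz with ⟨z, hz, -⟩ | ⟨hz, -⟩
    · rw [hz]; exact z.2.le
    · exact hz.le
  refine Ex.mono (Ex.ite (IsNum.andT h1W (.lt (.var hcount (by omega)) (.lit (k := 2) (by omega))
    h1W) (.lt (.var (k := s₅.var 6) rfl (by omega)) (.var hG₅.card (by omega)) h1W)) (T := 2)
    (T' := 1) (fun h => ?_) fun h => ?_) (by simp [Term.cost, andT]) fun _ _ h => h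
  · rw [ind_ne_zero] at h
    obtain ⟨hlt, hlt'⟩ := h
    rcases hz with ⟨z, hz, hdz, hmax⟩ | ⟨hz, -⟩
    · exact Ex.set (.var hz (by omega))
        (.inl ⟨z, ⟨d, hdD, hdz.1, hdz.2, by omega, hmax⟩, by simp⟩)
    · omega
  · rw [ind_eq_zero] at h
    refine Ex.skip ?_
    rw [hseven]
    refine hskip fun c hc => h ⟨Nat.lt_succ_of_le hc.2.2.2.1, ?_⟩
    rcases hz with ⟨z, hz, -⟩ | ⟨-, hno⟩
    · rw [hz]; exact z.2
    · exact (hno c ⟨hc.2.1, hc.2.2.1⟩).elim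

/-- In a matching, the partner is the only neighbour to be compared with. -/
theorem isDominant_iff_of_matching (hM : InducesMatching G A) {v w : Fin n} (hv : v ∈ A)
    (hw : w ∈ A) (hvw : G.Adj v w) :
    IsDominant G A D v ↔ ¬ ∃ d, (d ∈ D ∧ G.Adj w d) ∧ ¬ G.Adj v d := by
  constructor
  · rintro h ⟨d, ⟨hd, hwd⟩, hvd⟩
    exact hvd (h.2 w hw hvw d hd hwd)
  · refine fun h => ⟨hv, fun u hu hvu d hd hud => ?_⟩
    by_contra hvd
    rw [hM v hv u hu w hw hvu hvw] at hud
    exact h ⟨d, ⟨hd, hud⟩, hvd⟩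

theorem Ex.findDominant (hG : HasMatrix G s) (hA : Flags s 5 (· ∈ A)) (hD : Flags s 6 (· ∈ D))
    (hM : InducesMatching G A) :
    Ex ((n + 2) ^ 3) findDominant s ((n + 1) * ((n + 1) * 120)) fun s' =>
      (∃ c : Fin n, IsDominant G A D c ∧ s'.var 7 = c) ∨
        (∀ c, ¬ IsDominant G A D c) ∧ s'.var 7 = s.var 7 := by
  have hW := word_bound n
  have h1W := one_lt_word n
  refine (Ex.forAll (n := n) (T := (n + 1) * 110) (fun k s' =>
      (∃ c : Fin n, IsDominant G A D c ∧ s'.var 7 = c) ∨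
        (∀ c : Fin n, c.val < k → ¬ IsDominant G A D c) ∧ s'.var 7 = s.var 7) hG.card (by omega)
    (by decide) (by decide) (fun _ _ _ h => by exact h) (.inr ⟨by simp, rfl⟩) ?_).mono
    (Nat.mul_le_mul_left _ (by omega))
    fun s' _ h => h.imp_right fun h => ⟨fun c => h.1 c c.2, h.2⟩
  intro v s₁ hs₁ hv₁ hinv
  have hvn := v.2
  have hG₁ := hG.of_agree hs₁ (by decide) (by decide)
  have hA₁ := hA.congr (hs₁.arr 5 (by decide))
  have hD₁ := hD.congr (hs₁.arr 6 (by decide))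
  have hskip : ¬ IsDominant G A D v →
      (∃ c : Fin n, IsDominant G A D c ∧ s₁.var 7 = c) ∨
        (∀ c : Fin n, c.val < v.val + 1 → ¬ IsDominant G A D c) ∧ s₁.var 7 = s.var 7 :=
    fun hno => hinv.imp_right fun h => ⟨fun c hc => by
      rcases lt_succ_cases hc with hc | rfl
      exacts [h.1 c hc, hno], h.2⟩
  refine Ex.mono (Ex.ite (.flagT hA₁ hv₁) (T := 2 + ((n + 1) * 29 + ((n + 1) * 40 + 5)))
    (T' := 1) (fun hvA => ?_) fun hvA => Ex.skip ?_)
    (by simp [Term.cost, flagT]; omega) fun _ _ h => h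
  swap
  · rw [ind_eq_zero] at hvA
    exact hskip fun h => hvA h.1
  rw [ind_ne_zero] at hvA
  refine Ex.seq (Q' := fun s => s = s₁.setVar 6 v) (.set (.var hv₁ (by omega)) rfl) ?_
  rintro s₂ hs₂ rfl
  have hG₂ := hG₁.of_agree hs₂ (by decide) (by decide)
  have hA₂ : Flags (s₁.setVar 6 v) 5 (· ∈ A) := hA₁
  have hv₂ := (hs₂.var 1 (by decide)).trans hv₁
  refine (Ex.mono (Ex.scan (fun w => w ∈ A ∧ G.Adj v w) hG₂.card (by omega)
    (by decide) (by decide) (by decide) fun w s' hs' hw => ?_) (by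
      simp [Term.cost, andT, flagT, adjT]) fun _ _ h => h).seq fun s₃ hs₃ h₃ => ?_
  · exact .andT h1W (.flagT (hA₂.congr (hs'.arr 5 (by decide))) hw)
      (.adjT (hG₂.of_agree hs' (by decide) (by decide)) ((hs'.var 1 (by decide)).trans hv₂) hw)
  have hG₃ := hG₂.of_agree hs₃ (by decide) (by decide)
  have hD₃ : Flags s₃ 6 (· ∈ D) :=
    hD₁.congr ((hs₃.arr 6 (by decide)).trans (hs₂.arr 6 (by decide)))
  have hv₃ := (hs₃.var 1 (by decide)).trans hv₂
  obtain ⟨w, hw, hdom⟩ : ∃ w : Fin n, s₃.var 6 = w ∧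
      (IsDominant G A D v ↔ ¬ ∃ d, (d ∈ D ∧ G.Adj w d) ∧ ¬ G.Adj v d) := by
    rcases h₃ with ⟨w, ⟨hwA, hvw⟩, hw⟩ | ⟨hno, hw⟩
    · exact ⟨w, hw, isDominant_iff_of_matching hM hvA hwA hvw⟩
    -- An isolated vertex is compared with itself, the default in register `6`, and passes the test.
    · refine ⟨v, hw.trans (by simp), iff_of_true ⟨hvA, fun u hu hvu => (hno u ⟨hu, hvu⟩).elim⟩ ?_⟩
      rintro ⟨d, ⟨-, h⟩, h'⟩
      exact h' h
  refine (Ex.mono (Ex.count (fun d => (d ∈ D ∧ G.Adj w d) ∧ ¬ G.Adj v d) hG₃.card (by omega)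
    (by decide) (by decide) (by decide) fun d s' hs' hd => ?_) (by
      simp [Term.cost, andT, notT, flagT, adjT]) fun _ _ h => h).seq fun s₄ hs₄ h₄ => ?_
  · have hG' := hG₃.of_agree hs' (by decide) (by decide)
    exact .andT h1W (.andT h1W (.flagT (hD₃.congr (hs'.arr 6 (by decide))) hd)
      (.adjT hG' ((hs'.var 6 (by decide)).trans hw) hd))
      (.notT h1W (.adjT hG' ((hs'.var 1 (by decide)).trans hv₃) hd))
  have hseven : s₄.var 7 = s₁.var 7 := by
    rw [hs₄.var 7 (by decide), hs₃.var 7 (by decide), hs₂.var 7 (by decide)]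
  have hle := (Finset.card_le_univ (Finset.univ.filter fun d =>
    (d ∈ D ∧ G.Adj w d) ∧ ¬ G.Adj v d)).trans_eq (Fintype.card_fin n)
  refine Ex.mono (Ex.ite (IsNum.var h₄ (by omega)) (T := 1) (T' := 2) (fun h => ?_) fun h => ?_)
    (by simp [Term.cost]) fun _ _ h => h
  · rw [Ne, card_filter_eq_zero, ← hdom] at h
    refine Ex.skip ?_
    rw [hseven]
    exact hskip h
  · rw [card_filter_eq_zero, ← hdom] at h
    exact Ex.set (.var ((hs₄.var 1 (by decide)).trans hv₃) (by omega)) (.inl ⟨v, h, by simp⟩)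

theorem Ex.applySelection_loop (hG : HasMatrix G s) (hA : Flags s 5 (· ∈ A))
    (hD : Flags s 6 (· ∈ D)) {c : Fin n} (hc : s.var 7 = c) :
    Ex ((n + 2) ^ 3) (Ram.forAll 2 (.seq (.put 5 (.var 2) (Ram.andT (Ram.flagT 5 2)
      (Ram.notT (Ram.adjT 7 2)))) (.put 6 (.var 2) (Ram.andT (Ram.flagT 6 2)
      (Ram.notT (Ram.adjT 7 2)))))) s
      ((n + 1) * 50) fun s' =>
      Flags s' 5 (fun v => v ∈ A ∧ ¬ G.Adj c v) ∧ Flags s' 6 (fun v => v ∈ D ∧ ¬ G.Adj c v) := by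
  have hW := word_bound n
  have h1W := one_lt_word n
  refine (Ex.forAll (n := n) (T := 40) (fun k s' => ∀ v : Fin n,
    (v.val < k → s'.arr 5 v = ind (v ∈ A ∧ ¬ G.Adj c v) ∧ s'.arr 6 v = ind (v ∈ D ∧ ¬ G.Adj c v)) ∧
    (k ≤ v.val → s'.arr 5 v = ind (v ∈ A) ∧ s'.arr 6 v = ind (v ∈ D)))
    hG.card (by omega) (by decide) (by decide) (fun _ _ _ h => h) ?_ ?_).mono
    le_rfl fun s' _ h => ⟨fun v => ((h v).1 v.2).1, fun v => ((h v).1 v.2).2⟩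
  · exact fun v => ⟨fun h => (Nat.not_lt_zero _ h).elim, fun _ => ⟨hA v, hD v⟩⟩
  intro k s₁ hs₁ hk₁ hinv
  have hkn := k.2
  have hG₁ := hG.of_agree hs₁ (by decide) (by decide)
  have hc₁ := (hs₁.var 7 (by decide)).trans hc
  obtain ⟨h5, h6⟩ := (hinv k).2 le_rfl
  have hle5 := ind_le_one (k ∈ A)
  have hle6 := ind_le_one (k ∈ D)
  refine Ex.mono ((Ex.put (IsNum.var (k := k) hk₁ (by omega)) (IsNum.andT h1W
    (P := k ∈ A) (.get (.var hk₁ (by omega)) h5 (by omega)) (.notT h1W (.adjT hG₁ hc₁ hk₁)))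
    (Q := fun s => s = s₁.setArr 5 k (ind (k ∈ A ∧ ¬ G.Adj c k))) rfl).seq (T' := 14) ?_)
    (by simp [Term.cost, andT, notT, adjT]) fun _ _ h => h
  rintro s₂ hs₂ rfl
  have hG₂ := hG₁.of_agree hs₂ (by decide) (by decide)
  refine Ex.mono (Ex.put (IsNum.var (k := k) hk₁ (by omega)) (IsNum.andT h1W
    (P := k ∈ D) (.get (.var hk₁ (by omega)) ?_ (by omega)) (.notT h1W (.adjT hG₂ hc₁ hk₁))) ?_)
    (by simp [Term.cost, andT, notT, flagT, adjT]) fun _ _ h => h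
  · rw [hs₂.arr 6 (by decide), h6]
  · intro v
    simp only [State.setArr_arr, Fin.val_inj]
    by_cases hvk : v = k
    · subst hvk; simp
    · have := Fin.val_ne_of_ne hvk
      simp only [hvk, and_false, if_false]
      exact ⟨fun h => (hinv v).1 (by omega), fun h => (hinv v).2 (by omega)⟩

theorem Ex.applySelection (hG : HasMatrix G s) (hA : Flags s 5 (· ∈ A)) (hD : Flags s 6 (· ∈ D))
    {P : Fin n → Prop} (hc : (∃ c : Fin n, P c ∧ s.var 7 = c) ∨ (∀ c, ¬ P c) ∧ s.var 7 = n) :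
    Ex ((n + 2) ^ 3) applySelection s ((n + 1) * 60) fun s' =>
      (∃ c, P c ∧ Flags s' 5 (· ∈ restA G A c) ∧ Flags s' 6 (· ∈ restD G D c)) ∨
        (∀ c, ¬ P c) ∧ Flags s' 5 (· ∈ A) ∧ Flags s' 6 (· ∈ D) := by
  have hW := word_bound n
  have h1W := one_lt_word n
  have h7 : s.var 7 ≤ n := by
    rcases hc with ⟨c, -, hc⟩ | ⟨-, hc⟩
    · rw [hc]; exact c.2.le
    · exact hc.le
  refine Ex.mono (Ex.ite (.lt (.var (k := s.var 7) rfl (by omega)) (.var hG.card (by omega)) h1W)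
    (T := (n + 1) * 50 + 3) (T' := 1) (fun h => ?_) fun h => ?_)
    (by simp [Term.cost]; omega) fun _ _ h => h
  · rw [ind_ne_zero] at h
    rcases hc with ⟨c, hcP, hc⟩ | ⟨-, hc⟩
    swap
    · omega
    refine (Ex.applySelection_loop hG hA hD hc).seq fun s₁ hs₁ h₁ => ?_
    have hc₁ := (hs₁.var 7 (by decide)).trans hc
    -- The loop removes only neighbours, and c is not adjacent to itself; this last write removes c.
    refine Ex.put (.var hc₁ (by omega)) (.lit (by omega)) (.inl ⟨c, hcP, fun v => ?_, fun v => ?_⟩)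
    · rw [State.setArr_arr, h₁.1 v]
      by_cases hvc : v = c
      · subst hvc
        rw [if_pos ⟨rfl, rfl⟩, ind_of_not (by simp [mem_restA])]
      · rw [if_neg (fun h => hvc (Fin.ext h.2))]
        exact ind_congr (by simp [mem_restA, hvc])
    · rw [State.setArr_arr_of_ne _ _ _ (by decide), h₁.2 v]
      exact ind_congr (by simp [mem_restD])
  · rw [ind_eq_zero] at h
    rcases hc with ⟨c, -, hc⟩ | ⟨hno, -⟩
    · rw [hc] at h; exact (h c.2).elim
    · exact Ex.skip (.inr ⟨hno, hA, hD⟩)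

theorem Ex.selectionRound (hG : HasMatrix G s) (hA : Flags s 5 (· ∈ A)) (hD : Flags s 6 (· ∈ D))
    (hM : InducesMatching G A) :
    Ex ((n + 2) ^ 3) selectionRound s ((n + 1) * ((n + 1) * 430)) fun s' =>
      (∃ c, IsEligible G A D c ∧ Flags s' 5 (· ∈ restA G A c) ∧ Flags s' 6 (· ∈ restD G D c)) ∨
        (∀ c, ¬ IsEligible G A D c) ∧ Flags s' 5 (· ∈ A) ∧ Flags s' 6 (· ∈ D) := by
  have hW := word_bound n
  refine Ex.mono (Ex.seq (Q' := fun s' => s' = s.setVar 7 n)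
    (.set (.var hG.card (by omega)) rfl) (T' := (n + 1) * ((n + 1) * 60) +
      ((n + 1) * ((n + 1) * 180) + ((n + 1) * ((n + 1) * 120) + (n + 1) * 60))) ?_) (by
      simp only [Term.cost]; nlinarith) fun _ _ h => h
  rintro s₁ hs₁ rfl
  have hG₁ := hG.of_agree hs₁ (by decide) (by decide)
  have hA₁ : Flags (s.setVar 7 n) 5 (· ∈ A) := hA
  have hD₁ : Flags (s.setVar 7 n) 6 (· ∈ D) := hD
  refine (Ex.computeDegrees hG₁ hD₁).seq fun s₂ hs₂ hdeg => ?_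
  have hG₂ := hG₁.of_agree hs₂ (by decide) (by decide)
  have hA₂ := hA₁.congr (hs₂.arr 5 (by decide))
  have hD₂ := hD₁.congr (hs₂.arr 6 (by decide))
  refine (Ex.findCritical hG₂ hA₂ hD₂ hdeg ((hs₂.var 7 (by decide)).trans (by simp))).seq
    fun s₃ hs₃ hcrit => ?_
  have hG₃ := hG₂.of_agree hs₃ (by decide) (by decide)
  have hA₃ := hA₂.congr (hs₃.arr 5 (by decide))
  have hD₃ := hD₂.congr (hs₃.arr 6 (by decide))
  refine (Ex.findDominant hG₃ hA₃ hD₃ hM).seq fun s₄ hs₄ hdom => ?_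
  refine Ex.applySelection (hG₃.of_agree hs₄ (by decide) (by decide))
    (hA₃.congr (hs₄.arr 5 (by decide))) (hD₃.congr (hs₄.arr 6 (by decide))) ?_
  -- The dominant search comes last and overwrites register `7`, so a critical vertex is used only
  -- when no vertex is dominant, the case in which it is forced.
  rcases hdom with ⟨c, hc, h7⟩ | ⟨hno, h7⟩
  · exact .inl ⟨c, .inl hc, h7⟩
  · rw [h7]
    rcases hcrit with ⟨c, hc, h7⟩ | ⟨hno', h7⟩
    · exact .inl ⟨c, .inr ⟨hno, hc⟩, h7⟩
    · refine .inr ⟨fun c hc => ?_, h7⟩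
      rcases hc with hc | ⟨-, d, hc⟩
      exacts [hno c hc, hno' c d hc]

/-- Puts vertices into the independent set as long as possible. -/
def selectAll : Prog := Ram.forAll 3 Ram.selectionRound

/-- Each successful round removes a vertex from A, and once no vertex is eligible the sets stay
unchanged; so n rounds suffice. -/
theorem Ex.selectAll (hG : HasMatrix G s) (hA : Flags s 5 (· ∈ A)) (hD : Flags s 6 (· ∈ D))
    (hI : MatchingInstance G A D) :
    Ex ((n + 2) ^ 3) selectAll s ((n + 1) * ((n + 1) * ((n + 1) * 440))) fun s' =>
      ∃ A' D', Flags s' 5 (· ∈ A') ∧ Flags s' 6 (· ∈ D') ∧ MatchingInstance G A' D' ∧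
        (HasIndepDominating G A' D' ↔ HasIndepDominating G A D) ∧ ∀ c, ¬ IsEligible G A' D' c := by
  have hW := word_bound n
  refine (Ex.forAll (n := n) (T := (n + 1) * ((n + 1) * 430)) (fun k s' =>
      ∃ A' D', Flags s' 5 (· ∈ A') ∧ Flags s' 6 (· ∈ D') ∧ MatchingInstance G A' D' ∧
        (HasIndepDominating G A' D' ↔ HasIndepDominating G A D) ∧
        ((∀ c, ¬ IsEligible G A' D' c) ∨ A'.card + k ≤ n)) hG.card (by omega)
    (by decide) (by decide) (fun _ _ _ h => h) ⟨A, D, hA, hD, hI, Iff.rfl, .inr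
      ((Finset.card_le_univ _).trans_eq (Fintype.card_fin n))⟩ ?_).mono
    (Nat.mul_le_mul_left _ (by nlinarith)) ?_
  · rintro k s₁ hs₁ - ⟨A', D', hA', hD', hI', hiff, hdone⟩
    refine (Ex.selectionRound (hG.of_agree hs₁ (by decide) (by decide)) hA' hD'
      hI'.matching).mono le_rfl ?_
    rintro s₂ - (⟨c, hc, hA₂, hD₂⟩ | ⟨hno, hA₂, hD₂⟩)
    · refine ⟨_, _, hA₂, hD₂, hI'.mono (restA_subset c) (restD_subset c),
        (hc.hasIndepDominating_rest_iff hI').trans hiff, .inr ?_⟩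
      have := card_restA_lt (G := G) hc.mem
      have := hdone.resolve_left fun h => h c hc
      omega
    · exact ⟨A', D', hA₂, hD₂, hI', hiff, .inl hno⟩
  · rintro s' - ⟨A', D', hA', hD', hI', hiff, hdone⟩
    refine ⟨A', D', hA', hD', hI', hiff, fun c hc => ?_⟩
    -- After n rounds the alternative `A'.card + n ≤ n` makes A' empty, but an eligible vertex lies
    -- in A'.
    have := hdone.resolve_left fun h => h c hc
    have := Finset.card_pos.2 ⟨c, hc.mem⟩
    omega

/-- Register `0` becomes `1` if every vertex of the set in array `6` has a neighbour in the set in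
array `5`, and `0` otherwise. -/
def answer : Prog :=
  .seq (.set 6 (.lit 0)) (.seq
    (Ram.forAll 1 (.seq (Ram.count 5 2 (Ram.andT (Ram.flagT 5 2) (Ram.adjT 1 2)))
      (.ite (Ram.andT (Ram.flagT 6 1) (Ram.notT (.var 5))) (.set 6 (.lit 1)) .skip)))
    (.set 0 (Ram.notT (.var 6))))

theorem Ex.answer (hG : HasMatrix G s) (hA : Flags s 5 (· ∈ A)) (hD : Flags s 6 (· ∈ D)) :
    Ex ((n + 2) ^ 3) answer s ((n + 1) * ((n + 1) * 70)) fun s' =>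
      s'.var 0 = ind (∀ d ∈ D, ∃ v ∈ A, G.Adj d v) := by
  have hW := word_bound n
  have h1W := one_lt_word n
  refine Ex.mono (Ex.seq (Q' := fun s' => s' = s.setVar 6 0) (.set (.lit (by omega)) rfl)
    (T' := (n + 1) * ((n + 1) * 60) + 4) ?_) (by simp only [Term.cost]; nlinarith) fun _ _ h => h
  rintro s₁ hs₁ rfl
  have hG₁ := hG.of_agree hs₁ (by decide) (by decide)
  refine ((Ex.forAll (n := n) (T := (n + 1) * 50) (fun k s' =>
    s'.var 6 = ind (∃ d : Fin n, d.val < k ∧ d ∈ D ∧ ¬ ∃ v, v ∈ A ∧ G.Adj d v)) hG₁.card (by omega)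
    (by decide) (by decide) (fun _ _ _ h => by exact h) ?_ ?_).mono
    (Nat.mul_le_mul_left _ (by omega)) fun _ _ h => h).seq fun s₂ hs₂ h₂ => ?_
  · rw [ind_of_not (by simp)]; rfl
  · intro d s₂ hs₂ hd₂ h6
    have hdn := d.2
    have hA₂ : Flags s₂ 5 (· ∈ A) := hA.congr (hs₂.arr 5 (by decide))
    have hD₂ : Flags s₂ 6 (· ∈ D) := hD.congr (hs₂.arr 6 (by decide))
    have hG₂ := hG₁.of_agree hs₂ (by decide) (by decide)
    refine Ex.mono ((Ex.count_adj hG₂ hA₂ hd₂ (by decide)).seq (T' := 11)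
      fun s₃ hs₃ h₃ => ?_) (by omega) fun _ _ h => h
    obtain ⟨c, hcn, hc, hc0⟩ := h₃
    have h6' := (hs₃.var 6 (by decide)).trans h6
    refine Ex.mono (Ex.ite (IsNum.andT h1W (.flagT (hD₂.congr (hs₃.arr 6 (by decide)))
      ((hs₃.var 1 (by decide)).trans hd₂)) (((IsNum.var hc (by omega)).eq (.lit (by omega))
      h1W).congr hc0)) (T := 2) (T' := 1) (fun h => ?_) fun h => ?_)
      (by simp [Term.cost, andT, notT, flagT]) fun _ _ h => h
    · rw [ind_ne_zero] at h
      refine Ex.set (.lit (by omega)) ?_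
      rw [State.setVar_var_self, ind_of]
      exact ⟨d, Nat.lt_succ_self _, h⟩
    · rw [ind_eq_zero] at h
      refine Ex.skip ?_
      rw [h6']
      refine ind_congr ⟨fun ⟨e, he, he'⟩ => ⟨e, by omega, he'⟩, ?_⟩
      rintro ⟨e, he, he'⟩
      rcases lt_succ_cases he with he | rfl
      exacts [⟨e, he, he'⟩, (h he').elim]
  · refine Ex.set ((IsNum.notT h1W (.var h₂ ((ind_le_one _).trans_lt h1W))).congr
      (P' := ∀ d ∈ D, ∃ v ∈ A, G.Adj d v) ?_) (by simp)
    push Not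
    exact forall_congr' fun d => ⟨fun h => h d.2, fun h _ => h⟩

end Graph

end Ram

namespace Ram

/-! ### The main program -/

/-- Decides whether a nondegenerate bipartite subgraph is generating. -/
def decideNonempty : Prog :=
  .seq classify (.seq restrictOuter (.seq deleteTwins (.seq selectAll answer)))

/-- Decides whether a bipartite subgraph is generating. -/
def decideGenerating : Prog :=
  .seq buildMatrix (.seq (count 5 1 (flagT 2 1)) (.seq (count 6 1 (flagT 3 1))
    (.ite (.bin .mul (.var 5) (.var 6)) decideNonempty (.set 0 (.lit 1)))))

section Graph

variable {n : ℕ} {G : SimpleGraph (Fin n)} {s : State} {X Y : Finset (Fin n)}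

theorem Ex.decideNonempty (h6 : (SimpleGraph.cycleGraph 6).Free G)
    (h7 : (SimpleGraph.cycleGraph 7).Free G)
    (hB : IsInducedCompleteBipartite G (X : Set (Fin n)) (Y : Set (Fin n))) (hX : X.Nonempty)
    (hY : Y.Nonempty) (hG : HasMatrix G s) (hX' : Flags s 2 (· ∈ X)) (hY' : Flags s 3 (· ∈ Y)) :
    Ex ((n + 2) ^ 3) decideNonempty s ((n + 1) * ((n + 1) * ((n + 1) * 800))) fun s' =>
      s'.var 0 = ind (IsGenerating G (X : Set (Fin n)) (Y : Set (Fin n))) := by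
  classical
  refine Ex.mono (Ex.seq (Ex.classify hG hX' hY') (T' := (n + 1) * ((n + 1) * 70) +
    ((n + 1) * ((n + 1) * 60) + ((n + 1) * ((n + 1) * ((n + 1) * 440)) +
      (n + 1) * ((n + 1) * 70)))) fun s₁ hs₁ h₁ => ?_) ?_ fun _ _ h => h
  swap
  -- The quadratic phases cost at most 350 (n + 1)², absorbed by the gap between 440 and 800 in the
  -- cubic term.
  · have : (n + 1) * ((n + 1) * 1) ≤ (n + 1) * ((n + 1) * (n + 1)) :=
      Nat.mul_le_mul_left _ (Nat.mul_le_mul_left _ (by omega))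
    have := Nat.zero_le ((n + 1) * ((n + 1) * (n + 1)))
    linarith
  have hG₁ := hG.of_agree hs₁ (by decide) (by decide)
  refine (Ex.restrictOuter hG₁ h₁.1 h₁.2).seq fun s₂ hs₂ h₂ => ?_
  have hG₂ := hG₁.of_agree hs₂ (by decide) (by decide)
  have hD₂ := h₁.1.congr (hs₂.arr 6 (by decide))
  refine (Ex.deleteTwins hG₂ h₂ (twinStructure_outerVertices h6 h7 hB hX hY)).seq
    fun s₃ hs₃ h₃ => ?_
  obtain ⟨A, hAsub, hA, hM, hiff⟩ := h₃
  have hG₃ := hG₂.of_agree hs₃ (by decide) (by decide)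
  have hD₃ := hD₂.congr (hs₃.arr 6 (by decide))
  refine (Ex.selectAll hG₃ hA hD₃
    ⟨hM, (crossFree_outerVertices h6 h7 hB hX hY).mono hAsub subset_rfl⟩).seq fun s₄ hs₄ h₄ => ?_
  obtain ⟨A', D', hA', hD', hI, hiff', hdone⟩ := h₄
  refine (Ex.answer (hG₃.of_agree hs₄ (by decide) (by decide)) hA' hD').mono le_rfl
    fun s₅ _ h₅ => ?_
  rw [h₅]
  refine ind_congr ?_
  rw [isGenerating_iff hB hX hY, ← hiff, ← hiff']
  -- In the terminal situation the obvious necessary condition, a neighbour in A' for each vertex of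
  -- D', is also sufficient.
  refine ⟨hI.hasIndepDominating_of_terminal hdone, ?_⟩
  rintro ⟨S, hSA, -, hdom⟩ d hd
  obtain ⟨v, hv, hvd⟩ := hdom d hd
  exact ⟨v, hSA hv, hvd.symm⟩

theorem Ex.count_flags {r a : ℕ} {P : Finset (Fin n)} (hn : s.var 0 = n) (ha : Flags s a (· ∈ P))
    (hr : r ≠ 0 ∧ r ≠ 1) :
    Ex ((n + 2) ^ 3) (Ram.count r 1 (Ram.flagT a 1)) s ((n + 1) * 22) fun s' =>
      s'.var r = P.card := by
  have hW := word_bound n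
  refine (Ex.count (· ∈ P) hn (by omega) hr.2 hr.1 (by decide) fun v s' hs' hv =>
    .flagT (ha.congr (hs'.arr a ?_)) hv).mono le_rfl fun s' _ h => ?_
  · simp [Ram.count, Ram.forAll, Ram.forRange, Prog.arrs]
  · rw [h]
    exact congrArg _ (by ext; simp)

theorem Ex.decideGenerating {off adj : ℕ → ℕ} (h6 : (SimpleGraph.cycleGraph 6).Free G)
    (h7 : (SimpleGraph.cycleGraph 7).Free G)
    (hB : IsInducedCompleteBipartite G (X : Set (Fin n)) (Y : Set (Fin n)))
    (hadj : IsAdjList G off adj) :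
    Ex ((n + 2) ^ 3) decideGenerating (initState off adj X Y)
      ((n + 1) * ((n + 1) * ((n + 1) * 1000))) fun s' =>
      s'.var 0 = ind (IsGenerating G (X : Set (Fin n)) (Y : Set (Fin n))) := by
  have hW := word_bound n
  have hX₀ : Flags (initState off adj X Y) 2 (· ∈ X) := fun v => by
    simp [initState, ind, Fin.val_inj]
  have hY₀ : Flags (initState off adj X Y) 3 (· ∈ Y) := fun v => by
    simp [initState, ind, Fin.val_inj]
  refine Ex.mono (Ex.seq (Ex.buildMatrix hadj rfl rfl rfl fun _ => rfl) (T' := (n + 1) * 22 +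
    ((n + 1) * 22 + (4 + ((n + 1) * ((n + 1) * ((n + 1) * 800)) + 2)))) fun s₁ hs₁ hG₁ => ?_) ?_
    fun _ _ h => h
  swap
  · have h1 : (n + 1) * ((n + 1) * 1) ≤ (n + 1) * ((n + 1) * (n + 1)) :=
      Nat.mul_le_mul_left _ (Nat.mul_le_mul_left _ (by omega))
    have h2 : (n + 1) * 1 ≤ (n + 1) * (n + 1) := Nat.mul_le_mul_left _ (by omega)
    linarith
  have hX₁ := hX₀.congr (hs₁.arr 2 (by decide))
  have hY₁ := hY₀.congr (hs₁.arr 3 (by decide))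
  refine (Ex.count_flags hG₁.card hX₁ (by decide)).seq fun s₂ hs₂ h₂ => ?_
  have hG₂ := hG₁.of_agree hs₂ (by decide) (by decide)
  have hY₂ := hY₁.congr (hs₂.arr 3 (by decide))
  refine (Ex.count_flags hG₂.card hY₂ (by decide)).seq fun s₃ hs₃ h₃ => ?_
  have hG₃ := hG₂.of_agree hs₃ (by decide) (by decide)
  have hX₃ := hX₁.congr ((hs₃.arr 2 (by decide)).trans (hs₂.arr 2 (by decide)))
  have hY₃ := hY₂.congr (hs₃.arr 3 (by decide))
  have hXn := (Finset.card_le_univ X).trans_eq (Fintype.card_fin n)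
  have hYn := (Finset.card_le_univ Y).trans_eq (Fintype.card_fin n)
  have hmul := Nat.mul_le_mul hXn hYn
  refine Ex.ite (e := .bin .mul (.var 5) (.var 6)) (k := X.card * Y.card)
    (.bin .mul (.var ((hs₃.var 5 (by decide)).trans h₂) (by omega)) (.var h₃ (by omega))
      (by simp only [Op.val]; omega)) (fun h => ?_) fun h => ?_
  · obtain ⟨hX, hY⟩ := mul_ne_zero_iff.1 h
    exact Ex.decideNonempty h6 h7 hB (Finset.card_ne_zero.1 hX) (Finset.card_ne_zero.1 hY) hG₃
      hX₃ hY₃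
  · refine Ex.set (.lit (by omega)) ?_
    rw [State.setVar_var_self, ind_of]
    refine isGenerating_of_eq_empty hB ?_
    simpa using h

end Graph

end Ram

/-- One program decides, for every graph `G` without cycles of lengths 6 and 7 and every induced
complete bipartite subgraph of `G`, whether the subgraph is generating, in
`O(|V| ^ 2 * (|V| + |E|))` steps on a machine with words of `O(log |V|)` bits. The answer is left
in register `0`. -/
theorem mainTheorem3 :
    ∃ (P : Ram.Prog) (c C : ℕ), ∀ (n : ℕ) (G : SimpleGraph (Fin n)) (X Y : Finset (Fin n))
      (off adj : ℕ → ℕ),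
      (SimpleGraph.cycleGraph 6).Free G → (SimpleGraph.cycleGraph 7).Free G →
      IsInducedCompleteBipartite G (X : Set (Fin n)) (Y : Set (Fin n)) →
      IsAdjList G off adj →
      ∃ (t : ℕ) (s : Ram.State),
        Ram.Run ((n + 2) ^ c) P (initState off adj X Y) t s ∧
        t ≤ C * (n ^ 2 * (n + G.edgeSet.ncard) + 1) ∧
        ((IsGenerating G (X : Set (Fin n)) (Y : Set (Fin n)) ∧ s.var 0 = 1) ∨
          (¬ IsGenerating G (X : Set (Fin n)) (Y : Set (Fin n)) ∧ s.var 0 = 0)) := by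
  -- The exponent 3 comes from `word_bound`; 8000 = 1000 · 8 since n + 1 ≤ 2n for n ≥ 1, and the
  -- summand 1 covers n = 0.
  refine ⟨Ram.decideGenerating, 3, 8000, fun n G X Y off adj h6 h7 hB hadj => ?_⟩
  obtain ⟨t, s, hrun, ht, hs⟩ := Ram.Ex.decideGenerating h6 h7 hB hadj
  refine ⟨t, s, hrun, ht.trans ?_, ?_⟩
  · have hcube : (n + 1) * ((n + 1) * (n + 1)) ≤ 8 * (n ^ 2 * n + 1) := by
      rcases Nat.eq_zero_or_pos n with rfl | hn
      · simp
      · calc (n + 1) * ((n + 1) * (n + 1)) ≤ (2 * n) * ((2 * n) * (2 * n)) := by gcongr <;> omega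
          _ = 8 * (n ^ 2 * n) := by ring
          _ ≤ 8 * (n ^ 2 * n + 1) := by omega
    calc (n + 1) * ((n + 1) * ((n + 1) * 1000)) = 1000 * ((n + 1) * ((n + 1) * (n + 1))) := by ring
      _ ≤ 1000 * (8 * (n ^ 2 * n + 1)) := Nat.mul_le_mul_left _ hcube
      _ = 8000 * (n ^ 2 * n + 1) := by ring
      _ ≤ 8000 * (n ^ 2 * (n + G.edgeSet.ncard) + 1) := by gcongr; omega
  · by_cases h : IsGenerating G (X : Set (Fin n)) (Y : Set (Fin n))
    · exact .inl ⟨h, hs.trans (Ram.ind_of h)⟩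
    · exact .inr ⟨h, hs.trans (Ram.ind_of_not h)⟩
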